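/- Let $a_1>a_2>a_3$ be real numbers, $A=\mathrm{diag}(a_1,a_2,a_3)$, and write $e^{i\theta\widehat A}X=e^{i\theta A}Xe^{-i\theta A}$ for $3\times 3$ matrices $X$. For $k\in\mathbb N$ and $s\ge 0$ let $$H^{k,s}(\mathbb R)=\{f\in L^2(\mathbb R): (1+|x|^s)f\in L^2(\mathbb R),\ \partial^j f\in L^2(\mathbb R)\ (j=1,\dots,k)\},$$ with weak derivatives and complex-valued $f$. Let $p_{12},p_{13},p_{23}\in H^{1,2}(\mathbb R)$ (the initial data of the three-wave resonant interaction equation) and $$P=\begin{pmatrix}0&p_{12}&p_{13}\\-\bar p_{12}&0&p_{23}\\-\bar p_{13}&-\bar p_{23}&0\end{pmatrix}.$$ Then for every real $z$ the Volterra equations $$\mu_\pm(x,z)=I+\int_{\pm\infty}^{x}e^{iz(x-y)\widehat A}\bigl(P(y)\mu_\pm(y,z)\bigr)\,dy,\qquad x\in\mathbb R,$$ (with absolutely convergent integrals) have unique solutions $\mu_+$ and $\mu_-$, and there is a unique scattering matrix $S(z)=(s_{ij}(z))_{3\times 3}$ with $\mu_+(x,z)=\mu_-(x,z)\,e^{izx\widehat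 A}S(z)$ for all $x,z\in\mathbb R$. Let $S^A=(s^A_{ij})$ be the cofactor matrix of $S$, and assume that there are no spectral singularities, i.e. $s_{11}(z)\neq 0$ and $s^A_{33}(z)\neq 0$ for all $z\in\mathbb R$. Then the reflection coefficients $$r_1=\frac{s_{12}}{s_{11}},\qquad r_2=\frac{s_{31}}{s_{33}},\qquad r_3=\frac{s_{32}}{s_{33}},\qquad r_4=\frac{s_{13}}{s_{11}}$$ all belong to $H^{1,1}(\mathbb R)$. -/

import Mathlib

open MeasureTheory
open scoped ContDiff

/-- `g` is the weak (distributional) derivative of order `j` of `f : ℝ → ℂ`. -/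
def IsWeakDerivOfOrder (j : ℕ) (f g : ℝ → ℂ) : Prop :=
  ∀ φ : ℝ → ℝ, ContDiff ℝ ∞ φ → HasCompactSupport φ →
    ∫ x, iteratedDeriv j φ x • f x = (-1 : ℂ) ^ j * ∫ x, φ x • g x

/-- Membership in the weighted Sobolev space `H^{k,s}(ℝ)` of complex-valued functions:
`f ∈ L²`, `(1 + |x|^s) f ∈ L²`, and the weak derivatives of orders `1, …, k` exist and lie
in `L²`. -/
def MemWeightedSobolev (k : ℕ) (s : ℝ) (f : ℝ → ℂ) : Prop :=
  MemLp f 2 volume ∧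
  MemLp (fun x : ℝ => (1 + |x| ^ s) • f x) 2 volume ∧
  ∀ j : ℕ, 1 ≤ j → j ≤ k → ∃ g : ℝ → ℂ, MemLp g 2 volume ∧ IsWeakDerivOfOrder j f g

namespace ThreeWave

/-- The potential matrix `P(x)` built from `p₁₂, p₁₃, p₂₃`; it satisfies `P* = -P`. -/
noncomputable def potential (p₁₂ p₁₃ p₂₃ : ℝ → ℂ) (x : ℝ) : Matrix (Fin 3) (Fin 3) ℂ :=
  !![0, p₁₂ x, p₁₃ x;
     -(starRingEnd ℂ) (p₁₂ x), 0, p₂₃ x;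
     -(starRingEnd ℂ) (p₁₃ x), -(starRingEnd ℂ) (p₂₃ x), 0]

/-- `e^{iθÂ} X = e^{iθA} X e^{-iθA}` for `A = diag(a₁, a₂, a₃)`. -/
noncomputable def expHat (a : Fin 3 → ℝ) (θ : ℝ) (X : Matrix (Fin 3) (Fin 3) ℂ) :
    Matrix (Fin 3) (Fin 3) ℂ :=
  Matrix.diagonal (fun i => Complex.exp (Complex.I * θ * a i)) * X *
    Matrix.diagonal (fun i => Complex.exp (-(Complex.I * θ * a i)))

/-- `μ(x, z)` solves the Volterra equation normalized at `+∞`, for all real `x` and `z`: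
`μ(x, z) = I + ∫_{+∞}^x e^{iz(x-y)Â} (P(y) μ(y, z)) dy`, the integral being absolutely
convergent. -/
def IsJostPlus (a : Fin 3 → ℝ) (P : ℝ → Matrix (Fin 3) (Fin 3) ℂ)
    (μ : ℝ → ℝ → Matrix (Fin 3) (Fin 3) ℂ) : Prop :=
  ∀ (x z : ℝ) (i j : Fin 3),
    IntegrableOn (fun y => expHat a (z * (x - y)) (P y * μ y z) i j) (Set.Ioi x) ∧
    μ x z i j = (1 : Matrix (Fin 3) (Fin 3) ℂ) i j -
      ∫ y in Set.Ioi x, expHat a (z * (x - y)) (P y * μ y z) i j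

/-- `μ(x, z)` solves the Volterra equation normalized at `-∞`, for all real `x` and `z`:
`μ(x, z) = I + ∫_{-∞}^x e^{iz(x-y)Â} (P(y) μ(y, z)) dy`, the integral being absolutely
convergent. -/
def IsJostMinus (a : Fin 3 → ℝ) (P : ℝ → Matrix (Fin 3) (Fin 3) ℂ)
    (μ : ℝ → ℝ → Matrix (Fin 3) (Fin 3) ℂ) : Prop :=
  ∀ (x z : ℝ) (i j : Fin 3),
    IntegrableOn (fun y => expHat a (z * (x - y)) (P y * μ y z) i j) (Set.Iio x) ∧
    μ x z i j = (1 : Matrix (Fin 3) (Fin 3) ℂ) i j +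
      ∫ y in Set.Iio x, expHat a (z * (x - y)) (P y * μ y z) i j

/-- `S(z)` is the scattering matrix relating `μ₊` and `μ₋`:
`μ₊(x, z) = μ₋(x, z) e^{izxÂ} S(z)` for all real `x` and `z`. -/
def IsScatteringMatrix (a : Fin 3 → ℝ) (μp μm : ℝ → ℝ → Matrix (Fin 3) (Fin 3) ℂ)
    (S : ℝ → Matrix (Fin 3) (Fin 3) ℂ) : Prop :=
  ∀ x z : ℝ, μp x z = μm x z * expHat a (z * x) (S z)

/-- The cofactor matrix `X^A`. -/
def cofactorMatrix (X : Matrix (Fin 3) (Fin 3) ℂ) : Matrix (Fin 3) (Fin 3) ℂ :=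
  X.adjugate.transpose

/-- `r₁ = s₁₂ / s₁₁`. -/
noncomputable def r₁ (S : ℝ → Matrix (Fin 3) (Fin 3) ℂ) (z : ℝ) : ℂ := S z 0 1 / S z 0 0

/-- `r₂ = s₃₁ / s₃₃`. -/
noncomputable def r₂ (S : ℝ → Matrix (Fin 3) (Fin 3) ℂ) (z : ℝ) : ℂ := S z 2 0 / S z 2 2

/-- `r₃ = s₃₂ / s₃₃`. -/
noncomputable def r₃ (S : ℝ → Matrix (Fin 3) (Fin 3) ℂ) (z : ℝ) : ℂ := S z 2 1 / S z 2 2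

/-- `r₄ = s₁₃ / s₁₁`. -/
noncomputable def r₄ (S : ℝ → Matrix (Fin 3) (Fin 3) ℂ) (z : ℝ) : ℂ := S z 0 2 / S z 0 0

end ThreeWave

/-!
The reflection coefficients are quotients of entries of the scattering matrix, so the point is to
show that `S` has square-integrable derivative, that `S - 1` is square integrable, and that the
off-diagonal entries remain so after multiplication by `z`.

**Interaction picture.** Put `M(x, z) = e^{-izxÂ} μ₊(x, z)`. The Volterra equation becomes the
linear system `∂ₓM = Q_z M`, `M(+∞, z) = 1`, with `Q_z(y) = e^{-izyÂ} P(y)` continuous, integrable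
and skew-adjoint (`coeff`, `IsPotential.isJostPlus_iff`). A weighted contraction gives existence
(`exists_isJost`). Skew-adjointness makes `M` unitary, so that every bound below is uniform in `z`.
The scattering matrix is the limit of `M` at `-∞` (`IsPotential.isScatteringMatrix_iff`), and is
unitary as well. The solution normalized at `-∞` is `M S*`, which after `x ↦ -x` is the Jost
solution of another potential of the same kind; each estimate on the right half-line therefore
yields one on the left half-line.

**`L²` bounds.** The entries of `A` are distinct and `P` has zero diagonal, so `∫ₓ^∞ Q_z` is, entry
by entry, a Fourier transform in `z`, and Plancherel's theorem bounds it in `L²(dz)` by the `L²`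
norm of `P` over `(x, ∞)`, which is `O((1 + x²)⁻¹)`. Hence `M - 1` is square integrable over
`x > 0`, `z ∈ ℝ` (`IsPotential.lintegral_jost_sub_one_lt_top`), and likewise `M - S` over `x < 0`.
For an off-diagonal weight `w` in `L²`, replacing `M` by its limits on the two half-lines leaves a
Fourier transform and an error controlled by Cauchy–Schwarz, so `z ↦ ∫ (e^{-izyÂ} w) M dy` is
bounded in `L²` by `w` (`IsPotential.exists_eLpNorm_integral_coeff_mul_le`). With `w = P` this is
`S - 1 ∈ L²`. The derivative `S'` is `-S` times the integral of `e^{-izyÂ}(-iy[A, P])` between `M*`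
and `M` (`IsSkewFamily.hasDerivAt_scatter`), and is estimated in the same way with two factors to
replace.

**The factor `z`.** Integrating the oscillation by parts, `z (1 - S) = z ∫ Q_z M` is expressed by
`B = commutatorInv a P`, the solution of a commutator equation with `A`: the boundary terms vanish
at infinity, the terms with `B'` and with the off-diagonal part of `B P` are covered by the
previous bound, and the diagonal part of `B P` contributes off the diagonal only square-integrable
terms. As `B'` is merely in `L²`, one works on `[-n, n]` and concludes by Fatou's lemma
(`IsPotential.memLp_id_mul_scatter`).

**Quotients.** `s_ii - 1` and its derivative are in `L²`, so `s_ii → 1` at infinity; together with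
continuity and the absence of zeros this bounds `|s_ii|` from below, and division by `s_ii`
preserves `H^{1,1}` (`memWeightedSobolev_div`). For `i = 3` the hypothesis concerns the cofactor,
which for a unitary matrix is the determinant times the conjugate of `s_33`.
-/

namespace ThreeWave

/-! ### Jost solutions of linear systems on the line -/

section JostODE

open Filter Topology Set

section TailIntegral

variable {E : Type*} [NormedAddCommGroup E] [NormedSpace ℝ E]

theorem tailIntegral_eq {f : ℝ → E} (hi : Integrable f) (x : ℝ) :
    ∫ y in Ioi x, f y = (∫ y in Ioi 0, f y) - ∫ y in (0 : ℝ)..x, f y := by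
  rw [← intervalIntegral.integral_Ioi_sub_Ioi' hi.integrableOn hi.integrableOn]
  abel

theorem hasDerivAt_tailIntegral [CompleteSpace E] {f : ℝ → E} (hc : Continuous f)
    (hi : Integrable f) (x : ℝ) :
    HasDerivAt (fun x => ∫ y in Ioi x, f y) (-f x) x := by
  have h : (fun x => ∫ y in Ioi x, f y) =
      fun x => (∫ y in Ioi 0, f y) - ∫ y in (0 : ℝ)..x, f y := funext (tailIntegral_eq hi)
  rw [h]
  exact (intervalIntegral.integral_hasDerivAt_right hi.intervalIntegrable
    (hc.stronglyMeasurableAtFilter _ _) hc.continuousAt).const_sub _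

theorem tendsto_tailIntegral_atTop {f : ℝ → E} (hi : Integrable f) :
    Tendsto (fun x => ∫ y in Ioi x, f y) atTop (𝓝 0) := by
  have h : (fun x => ∫ y in Ioi x, f y) =
      fun x => (∫ y in Ioi 0, f y) - ∫ y in (0 : ℝ)..x, f y := funext (tailIntegral_eq hi)
  rw [h]
  have := (tendsto_const_nhds (x := ∫ y in Ioi 0, f y) (f := atTop)).sub
    (intervalIntegral_tendsto_integral_Ioi 0 hi.integrableOn tendsto_id)
  simpa using this

theorem tendsto_tailIntegral_atBot {f : ℝ → E} (hi : Integrable f) :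
    Tendsto (fun x => ∫ y in Ioi x, f y) atBot (𝓝 (∫ y, f y)) := by
  have h : (fun x => ∫ y in Ioi x, f y) =
      fun x => (∫ y in Ioi 0, f y) + ∫ y in x..(0 : ℝ), f y := by
    funext x
    rw [tailIntegral_eq hi, intervalIntegral.integral_symm 0 x, sub_eq_add_neg]
  rw [h]
  have := (tendsto_const_nhds (x := ∫ y in Ioi 0, f y) (f := atBot)).add
    (intervalIntegral_tendsto_integral_Iic 0 hi.integrableOn tendsto_id)
  rwa [add_comm (∫ y in Ioi 0, f y) (∫ y in Iic 0, f y),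
    intervalIntegral.integral_Iic_add_Ioi hi.integrableOn hi.integrableOn] at this

end TailIntegral

variable {E : Type*} [CStarAlgebra E]

/-- The coefficients of the linear system `M' = Q M` that are treated here: continuous,
skew-adjoint and integrable over the line. -/
structure IsSkewPotential (Q : ℝ → E) : Prop where
  cont : Continuous Q
  skew : ∀ x, star (Q x) = -Q x
  integrable : Integrable Q

/-- `M` is the solution of `M' = Q M` that tends to `1` at `+∞`. -/
structure IsJost (Q M : ℝ → E) : Prop where
  hasDerivAt : ∀ x, HasDerivAt M (Q x * M x) x
  tendsto_atTop : Tendsto M atTop (𝓝 1)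

theorem IsJost.continuous {Q M : ℝ → E} (h : IsJost Q M) : Continuous M :=
  continuous_iff_continuousAt.2 fun x => (h.hasDerivAt x).continuousAt

/-- Only the integrability of `Q M` is assumed of `M`: the integral equation provides the
continuity, and then the differentiability, of `M`. -/
theorem isJost_of_eq_tailIntegral {Q M : ℝ → E} (hQ : Continuous Q)
    (hi : ∀ x, IntegrableOn (fun y => Q y * M y) (Ioi x))
    (hM : ∀ x, M x = 1 - ∫ y in Ioi x, Q y * M y) : IsJost Q M := by
  have key : ∀ a x, a < x → M x = M a + ∫ y in a..x, Q y * M y := by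
    intro a x hax
    rw [hM x, hM a, ← intervalIntegral.integral_Ioi_sub_Ioi' (hi a) (hi x)]
    abel
  have hc : Continuous M := by
    refine continuous_iff_continuousAt.2 fun x => ?_
    have hii : IntegrableOn (fun y => Q y * M y) (Icc (x - 1) (x + 1)) :=
      (hi (x - 2)).mono_set fun y hy => by
        simp only [mem_Icc, mem_Ioi] at *; linarith
    have h1 : ContinuousOn (fun t => M (x - 1) + ∫ y in (x - 1)..t, Q y * M y)
        (Icc (x - 1) (x + 1)) := by
      have := intervalIntegral.continuousOn_primitive_interval
        (f := fun y => Q y * M y) (μ := volume) (a := x - 1) (b := x + 1)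
        (by rwa [uIcc_of_le (by linarith)])
      rw [uIcc_of_le (by linarith)] at this
      exact continuousOn_const.add this
    have h2 := h1.continuousAt (Icc_mem_nhds (by linarith : x - 1 < x) (by linarith : x < x + 1))
    refine h2.congr ?_
    filter_upwards [Ioi_mem_nhds (by linarith : x - 1 < x)] with t ht
    exact (key _ _ ht).symm
  have hQM : Continuous fun y => Q y * M y := hQ.mul hc
  refine ⟨fun x => ?_, ?_⟩
  · have h1 : HasDerivAt (fun t => M (x - 1) + ∫ y in (x - 1)..t, Q y * M y) (Q x * M x) x :=
      (intervalIntegral.integral_hasDerivAt_right (hQM.intervalIntegrable _ _)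
        (hQM.stronglyMeasurableAtFilter _ _) hQM.continuousAt).const_add _
    refine h1.congr_of_eventuallyEq ?_
    filter_upwards [Ioi_mem_nhds (by linarith : x - 1 < x)] with t ht
    exact key _ _ ht
  · have h1 : Tendsto (fun x => M 0 + ∫ y in (0 : ℝ)..x, Q y * M y) atTop
        (𝓝 (M 0 + ∫ y in Ioi 0, Q y * M y)) :=
      tendsto_const_nhds.add (intervalIntegral_tendsto_integral_Ioi 0 (hi 0) tendsto_id)
    have h2 : M 0 + ∫ y in Ioi 0, Q y * M y = 1 := by rw [hM 0]; abel
    rw [h2] at h1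
    refine h1.congr' ?_
    filter_upwards [eventually_gt_atTop 0] with x hx
    exact (key _ _ hx).symm

/-- Existence of the Jost solution: in terms of `g = e^{-2m} M`, with
`m x = ∫_x^∞ ‖Q‖`, the Volterra operator is a contraction with constant `1/2` on the bounded
continuous functions. -/
theorem exists_isJost {Q : ℝ → E} (hQ : Continuous Q) (hi : Integrable Q) :
    ∃ M, IsJost Q M := by
  set m : ℝ → ℝ := fun x => ∫ y in Ioi x, ‖Q y‖ with hm
  have hm' : ∀ x, HasDerivAt m (-‖Q x‖) x := hasDerivAt_tailIntegral hQ.norm hi.norm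
  have hmc : Continuous m := continuous_iff_continuousAt.2 fun x => (hm' x).continuousAt
  have hm0 : ∀ x, 0 ≤ m x := fun x => integral_nonneg fun y => norm_nonneg _
  have hm1 : ∀ x, m x ≤ ∫ y, ‖Q y‖ := fun x =>
    setIntegral_le_integral hi.norm (Eventually.of_forall fun y => norm_nonneg _)
  set K := ∫ y, ‖Q y‖
  -- the weight `e^{2m} ‖Q‖` is the derivative of `-e^{2m} / 2`
  have hwint : Integrable fun y => Real.exp (2 * m y) * ‖Q y‖ := by
    refine Integrable.bdd_mul (c := Real.exp (2 * K)) hi.norm ?_ ?_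
    · exact (Real.continuous_exp.comp (continuous_const.mul hmc)).aestronglyMeasurable
    · refine Eventually.of_forall fun y => ?_
      rw [Real.norm_eq_abs, abs_of_pos (Real.exp_pos _)]
      exact Real.exp_le_exp.2 (by linarith [hm1 y])
  have hwval : ∀ x, ∫ y in Ioi x, Real.exp (2 * m y) * ‖Q y‖
      = (Real.exp (2 * m x) - 1) / 2 := by
    intro x
    have h1 : ∀ y ∈ Ici x, HasDerivAt (fun y => -(Real.exp (2 * m y) / 2))
        (Real.exp (2 * m y) * ‖Q y‖) y := by
      intro y _
      have := ((((hm' y).const_mul 2).exp).div_const 2).neg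
      refine this.congr_deriv ?_
      ring
    have h2 : Tendsto (fun y => -(Real.exp (2 * m y) / 2)) atTop (𝓝 (-(Real.exp (2 * 0) / 2))) := by
      have := tendsto_tailIntegral_atTop hi.norm
      exact (((Real.continuous_exp.tendsto _).comp (this.const_mul 2)).div_const 2).neg
    rw [integral_Ioi_of_hasDerivAt_of_tendsto' h1 hwint.integrableOn h2]
    simp; ring
  have hfint : ∀ g : BoundedContinuousFunction ℝ E,
      Integrable fun y => Real.exp (2 * m y) • (Q y * g y) := by
    intro g
    refine (hwint.mul_const ‖g‖).mono' ?_ ?_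
    · exact ((Real.continuous_exp.comp (continuous_const.mul hmc)).smul
        (hQ.mul g.continuous)).aestronglyMeasurable
    · refine Eventually.of_forall fun y => ?_
      rw [norm_smul, Real.norm_eq_abs, abs_of_pos (Real.exp_pos _), mul_assoc]
      gcongr
      exact (norm_mul_le _ _).trans (by gcongr; exact g.norm_coe_le_norm y)
  have hfcont : ∀ g : BoundedContinuousFunction ℝ E,
      Continuous fun y => Real.exp (2 * m y) • (Q y * g y) := fun g =>
    (Real.continuous_exp.comp (continuous_const.mul hmc)).smul (hQ.mul g.continuous)
  have hbd : ∀ (g : BoundedContinuousFunction ℝ E) (x : ℝ),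
      ‖∫ y in Ioi x, Real.exp (2 * m y) • (Q y * g y)‖ ≤ (Real.exp (2 * m x) - 1) / 2 * ‖g‖ := by
    intro g x
    rw [← hwval x, ← integral_mul_const]
    refine norm_integral_le_of_norm_le (hwint.mul_const ‖g‖).integrableOn
      (Eventually.of_forall fun y => ?_)
    rw [norm_smul, Real.norm_eq_abs, abs_of_pos (Real.exp_pos _), mul_assoc]
    gcongr
    exact (norm_mul_le _ _).trans (by gcongr; exact g.norm_coe_le_norm y)
  have hexp1 : ∀ x, Real.exp (-(2 * m x)) ≤ 1 := fun x =>
    Real.exp_le_one_iff.2 (by linarith [hm0 x])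
  have hexp2 : ∀ x, Real.exp (-(2 * m x)) * ((Real.exp (2 * m x) - 1) / 2) ≤ 1 / 2 := by
    intro x
    have : Real.exp (-(2 * m x)) * Real.exp (2 * m x) = 1 := by
      rw [← Real.exp_add]; simp
    nlinarith [Real.exp_pos (-(2 * m x))]
  let T : BoundedContinuousFunction ℝ E → BoundedContinuousFunction ℝ E := fun g =>
    BoundedContinuousFunction.ofNormedAddCommGroup
      (fun x => Real.exp (-(2 * m x)) • ((1 : E) - ∫ y in Ioi x, Real.exp (2 * m y) • (Q y * g y)))
      (by
        refine (Real.continuous_exp.comp (continuous_const.mul hmc).neg).smul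
          (continuous_const.sub (continuous_iff_continuousAt.2 fun x =>
            (hasDerivAt_tailIntegral (hfcont g) (hfint g) x).continuousAt)))
      (‖(1 : E)‖ + 1 / 2 * ‖g‖)
      (by
        intro x
        rw [norm_smul, Real.norm_eq_abs, abs_of_pos (Real.exp_pos _)]
        refine (mul_le_mul_of_nonneg_left (norm_sub_le _ _) (Real.exp_pos _).le).trans ?_
        rw [mul_add]
        have h1 := mul_le_mul_of_nonneg_right (hexp1 x) (norm_nonneg (1 : E))
        have h2 := mul_le_mul_of_nonneg_left (hbd g x) (Real.exp_pos (-(2 * m x))).le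
        have h3 := mul_le_mul_of_nonneg_right (hexp2 x) (norm_nonneg g)
        linarith)
  have hT : ContractingWith (1 / 2 : NNReal) T := by
    refine ⟨by norm_num, LipschitzWith.of_dist_le_mul fun g g' => ?_⟩
    rw [BoundedContinuousFunction.dist_le (by positivity)]
    intro x
    rw [dist_eq_norm, dist_eq_norm]
    have h1 : T g x - T g' x = Real.exp (-(2 * m x)) •
        -(∫ y in Ioi x, Real.exp (2 * m y) • (Q y * (g - g') y)) := by
      have : (∫ y in Ioi x, Real.exp (2 * m y) • (Q y * (g - g') y))
          = (∫ y in Ioi x, Real.exp (2 * m y) • (Q y * g y))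
            - ∫ y in Ioi x, Real.exp (2 * m y) • (Q y * g' y) := by
        rw [← integral_sub (hfint g).integrableOn (hfint g').integrableOn]
        refine integral_congr_ae (Eventually.of_forall fun y => ?_)
        simp [mul_sub, smul_sub]
      rw [this, neg_sub]
      change Real.exp (-(2 * m x)) • ((1 : E) - ∫ y in Ioi x, Real.exp (2 * m y) • (Q y * g y))
        - Real.exp (-(2 * m x)) • ((1 : E) - ∫ y in Ioi x, Real.exp (2 * m y) • (Q y * g' y)) = _
      rw [← smul_sub]
      congr 1
      abel
    rw [h1, norm_smul, norm_neg, Real.norm_eq_abs, abs_of_pos (Real.exp_pos _)]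
    have h2 := mul_le_mul_of_nonneg_left (hbd (g - g') x) (Real.exp_pos (-(2 * m x))).le
    have h3 := mul_le_mul_of_nonneg_right (hexp2 x) (norm_nonneg (g - g'))
    simp only [one_div, NNReal.coe_inv, NNReal.coe_ofNat] at *
    linarith
  obtain ⟨g, hg⟩ : ∃ g, T g = g := ⟨hT.fixedPoint T, hT.fixedPoint_isFixedPt⟩
  have hMg : ∀ y, Q y * (Real.exp (2 * m y) • g y) = Real.exp (2 * m y) • (Q y * g y) :=
    fun y => mul_smul_comm _ _ _
  refine ⟨fun x => Real.exp (2 * m x) • g x, isJost_of_eq_tailIntegral hQ ?_ ?_⟩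
  · intro x
    simp only [hMg]
    exact (hfint g).integrableOn
  · intro x
    simp only [hMg]
    have h1 : g x = Real.exp (-(2 * m x)) •
        ((1 : E) - ∫ y in Ioi x, Real.exp (2 * m y) • (Q y * g y)) := by
      conv_lhs => rw [← hg]
      rfl
    conv_lhs => rw [h1]
    rw [smul_smul, ← Real.exp_add]
    simp

end JostODE

/-! ### Unitarity, scattering and Duhamel's formula -/

section JostProperties

open Filter Topology Set

variable {E : Type*} [CStarAlgebra E]

theorem hasDerivAt_star_mul {Q₁ Q₂ M₁ M₂ : ℝ → E} (hQ₂ : ∀ x, star (Q₂ x) = -Q₂ x)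
    (h₁ : ∀ x, HasDerivAt M₁ (Q₁ x * M₁ x) x) (h₂ : ∀ x, HasDerivAt M₂ (Q₂ x * M₂ x) x) (x : ℝ) :
    HasDerivAt (fun x => star (M₂ x) * M₁ x) (star (M₂ x) * (Q₁ x - Q₂ x) * M₁ x) x := by
  refine ((h₂ x).star.mul (h₁ x)).congr_deriv ?_
  rw [star_mul, hQ₂]
  noncomm_ring

variable {Q M : ℝ → E}

/-- `star M * M'` has derivative zero, because `Q` is skew-adjoint, and tends to `1`. -/
theorem IsJost.star_mul_eq_one {M' : ℝ → E} (hQ : IsSkewPotential Q) (h : IsJost Q M)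
    (h' : IsJost Q M') (x : ℝ) : star (M x) * M' x = 1 := by
  have hd : ∀ x, HasDerivAt (fun x => star (M x) * M' x) 0 x := fun x => by
    simpa using hasDerivAt_star_mul hQ.skew h'.hasDerivAt h.hasDerivAt x
  have hlim : Tendsto (fun x => star (M x) * M' x) atTop (𝓝 1) := by
    simpa using h.tendsto_atTop.star.mul h'.tendsto_atTop
  have hconst : (fun x => star (M x) * M' x) = fun _ => star (M x) * M' x := by
    funext y
    exact is_const_of_deriv_eq_zero (fun x => (hd x).differentiableAt) (fun x => (hd x).deriv) y x
  rw [hconst] at hlim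
  exact tendsto_nhds_unique tendsto_const_nhds hlim

theorem IsSkewPotential.reflect (hQ : IsSkewPotential Q) : IsSkewPotential fun x => -Q (-x) where
  cont := (hQ.cont.comp continuous_neg).neg
  skew x := by simp [hQ.skew]
  integrable := hQ.integrable.comp_neg.neg

variable [IsDedekindFiniteMonoid E]

/-- In a Dedekind-finite algebra, such as that of square matrices, the isometry `M x` is unitary. -/
theorem IsJost.mem_unitary (hQ : IsSkewPotential Q) (h : IsJost Q M) (x : ℝ) :
    M x ∈ unitary E :=
  Unitary.mem_iff.2 ⟨h.star_mul_eq_one hQ h x, mul_eq_one_symm (h.star_mul_eq_one hQ h x)⟩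

theorem IsJost.unique {M' : ℝ → E} (hQ : IsSkewPotential Q) (h : IsJost Q M)
    (h' : IsJost Q M') : M' = M := by
  funext x
  have h1 := h.star_mul_eq_one hQ h' x
  have h2 := Unitary.mul_star_self_of_mem (h.mem_unitary hQ x)
  calc M' x = M x * star (M x) * M' x := by rw [h2, one_mul]
    _ = M x := by rw [mul_assoc, h1, mul_one]

theorem IsJost.norm_mul (hQ : IsSkewPotential Q) (h : IsJost Q M) (x : ℝ) (A : E) :
    ‖A * M x‖ = ‖A‖ := CStarRing.norm_mul_mem_unitary A (h.mem_unitary hQ x)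

theorem IsJost.norm_star_mul (hQ : IsSkewPotential Q) (h : IsJost Q M) (x : ℝ) (A : E) :
    ‖star (M x) * A‖ = ‖A‖ :=
  CStarRing.norm_mem_unitary_mul A (Unitary.star_mem (h.mem_unitary hQ x))

theorem IsJost.integrable_mul (hQ : IsSkewPotential Q) (h : IsJost Q M) :
    Integrable fun y => Q y * M y :=
  hQ.integrable.mono ((hQ.cont.mul h.continuous).aestronglyMeasurable)
    (Eventually.of_forall fun y => (h.norm_mul hQ y (Q y)).le)

theorem IsJost.eq_tailIntegral (hQ : IsSkewPotential Q) (h : IsJost Q M) (x : ℝ) :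
    M x = 1 - ∫ y in Ioi x, Q y * M y := by
  rw [integral_Ioi_of_hasDerivAt_of_tendsto' (fun y _ => h.hasDerivAt y)
    (h.integrable_mul hQ).integrableOn h.tendsto_atTop]
  abel

/-- The limit at `-∞` of the Jost solution `M` of `M' = Q M`, that is, the scattering matrix. It is
written as an integral; `IsJost.tendsto_atBot` identifies it with the limit. -/
noncomputable def scatter (Q M : ℝ → E) : E := 1 - ∫ y, Q y * M y

theorem IsJost.tendsto_atBot (hQ : IsSkewPotential Q) (h : IsJost Q M) :
    Tendsto M atBot (𝓝 (scatter Q M)) := by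
  rw [show M = fun x => 1 - ∫ y in Ioi x, Q y * M y from funext (h.eq_tailIntegral hQ)]
  refine tendsto_const_nhds.sub ?_
  have := tendsto_tailIntegral_atBot (h.integrable_mul hQ)
  simp_rw [← h.eq_tailIntegral hQ]
  exact this

theorem IsJost.scatter_mem_unitary (hQ : IsSkewPotential Q) (h : IsJost Q M) :
    scatter Q M ∈ unitary E := by
  have hl := h.tendsto_atBot hQ
  have h1 : Tendsto (fun x => star (M x) * M x) atBot (𝓝 (star (scatter Q M) * scatter Q M)) :=
    hl.star.mul hl
  simp_rw [h.star_mul_eq_one hQ h] at h1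
  have h2 := tendsto_nhds_unique h1 tendsto_const_nhds
  exact Unitary.mem_iff.2 ⟨h2, mul_eq_one_symm h2⟩

/-- The reflection `y ↦ -y` turns the solution normalized at `-∞` into a Jost solution. -/
theorem IsJost.reflect (hQ : IsSkewPotential Q) (h : IsJost Q M) :
    IsJost (fun x => -Q (-x)) fun x => M (-x) * star (scatter Q M) where
  hasDerivAt x := by
    have h1 : HasDerivAt (fun x => M (-x)) (-(Q (-x) * M (-x))) x := by
      refine ((h.hasDerivAt (-x)).scomp x (hasDerivAt_neg x)).congr_deriv ?_
      simp
    refine (h1.mul_const (star (scatter Q M))).congr_deriv ?_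
    noncomm_ring
  tendsto_atTop := by
    have h1 := ((h.tendsto_atBot hQ).comp tendsto_neg_atTop_atBot).mul_const
      (star (scatter Q M))
    rwa [Unitary.mul_star_self_of_mem (h.scatter_mem_unitary hQ)] at h1

variable {Q' M' : ℝ → E}

theorem IsJost.integrable_star_mul_mul {W : ℝ → E} (hQ : IsSkewPotential Q)
    (hQ' : IsSkewPotential Q') (h : IsJost Q M) (h' : IsJost Q' M') (hW : Integrable W) :
    Integrable fun y => star (M' y) * W y * M y :=
  hW.mono ((h'.continuous.star.aestronglyMeasurable.mul hW.1).mul h.continuous.aestronglyMeasurable)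
    (Eventually.of_forall fun y => by rw [h.norm_mul hQ, h'.norm_star_mul hQ'])

/-- Duhamel's formula comparing the Jost solutions of two systems. -/
theorem IsJost.duhamel (hQ : IsSkewPotential Q) (hQ' : IsSkewPotential Q') (h : IsJost Q M)
    (h' : IsJost Q' M') (x : ℝ) :
    star (M' x) * M x = 1 - ∫ y in Ioi x, star (M' y) * (Q y - Q' y) * M y := by
  have hlim : Tendsto (fun x => star (M' x) * M x) atTop (𝓝 1) := by
    simpa using h'.tendsto_atTop.star.mul h.tendsto_atTop
  rw [integral_Ioi_of_hasDerivAt_of_tendsto'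
    (fun y _ => hasDerivAt_star_mul hQ'.skew h.hasDerivAt h'.hasDerivAt y)
    (h.integrable_star_mul_mul hQ hQ' h' (hQ.integrable.sub hQ'.integrable)).integrableOn hlim]
  abel

theorem IsJost.duhamel_scatter (hQ : IsSkewPotential Q) (hQ' : IsSkewPotential Q')
    (h : IsJost Q M) (h' : IsJost Q' M') :
    star (scatter Q' M') * scatter Q M = 1 - ∫ y, star (M' y) * (Q y - Q' y) * M y := by
  have h1 : Tendsto (fun x => star (M' x) * M x) atBot
      (𝓝 (star (scatter Q' M') * scatter Q M)) :=
    (h'.tendsto_atBot hQ').star.mul (h.tendsto_atBot hQ)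
  have h2 : Tendsto (fun x => star (M' x) * M x) atBot
      (𝓝 (1 - ∫ y, star (M' y) * (Q y - Q' y) * M y)) := by
    simp_rw [h.duhamel hQ hQ' h']
    exact tendsto_const_nhds.sub (tendsto_tailIntegral_atBot
      (h.integrable_star_mul_mul hQ hQ' h' (hQ.integrable.sub hQ'.integrable)))
  exact tendsto_nhds_unique h1 h2

theorem IsJost.norm_sub_le (hQ : IsSkewPotential Q) (hQ' : IsSkewPotential Q') (h : IsJost Q M)
    (h' : IsJost Q' M') (x : ℝ) : ‖M x - M' x‖ ≤ ∫ y, ‖Q y - Q' y‖ := by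
  have h1 : star (M' x) * (M x - M' x) = -∫ y in Ioi x, star (M' y) * (Q y - Q' y) * M y := by
    rw [mul_sub, h.duhamel hQ hQ' h', h'.star_mul_eq_one hQ' h']
    abel
  have hi := (hQ.integrable.sub hQ'.integrable).norm
  rw [← h'.norm_star_mul hQ' x, h1, norm_neg]
  refine (norm_integral_le_of_norm_le hi.integrableOn (Eventually.of_forall fun y => ?_)).trans
    (setIntegral_le_integral hi (Eventually.of_forall fun y => norm_nonneg _))
  rw [h.norm_mul hQ, h'.norm_star_mul hQ']
  rfl

/-- The deviation of the Jost solution from `1` is controlled by the tail integral of the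
coefficients, without absolute values inside that integral: the oscillation of `Q` is kept. -/
theorem IsJost.norm_sub_one_le (hQ : IsSkewPotential Q) (h : IsJost Q M) (x : ℝ) :
    ‖M x - 1‖ ≤ ‖∫ t in Ioi x, Q t‖ + ∫ y in Ioi x, ‖Q y‖ * ‖∫ t in Ioi y, Q t‖ := by
  set T : ℝ → E := fun x => ∫ t in Ioi x, Q t with hT
  have hT' : ∀ x, HasDerivAt T (-Q x) x := hasDerivAt_tailIntegral hQ.cont hQ.integrable
  have hTc : Continuous T := continuous_iff_continuousAt.2 fun x => (hT' x).continuousAt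
  have hTb : ∀ y, ‖T y‖ ≤ ∫ t, ‖Q t‖ := fun y =>
    (norm_integral_le_integral_norm _).trans
      (setIntegral_le_integral hQ.integrable.norm (Eventually.of_forall fun y => norm_nonneg _))
  have hQT : Integrable fun y => Q y * T y :=
    (hQ.integrable.norm.mul_const (∫ t, ‖Q t‖)).mono'
      (hQ.cont.mul hTc).aestronglyMeasurable (Eventually.of_forall fun y =>
        (norm_mul_le _ _).trans (mul_le_mul_of_nonneg_left (hTb y) (norm_nonneg _)))
  have hQTn : Integrable fun y => ‖Q y‖ * ‖T y‖ :=
    (hQ.integrable.norm.mul_const (∫ t, ‖Q t‖)).mono'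
      (hQ.cont.norm.mul hTc.norm).aestronglyMeasurable (Eventually.of_forall fun y => by
        rw [Real.norm_eq_abs, abs_of_nonneg (by positivity)]
        exact mul_le_mul_of_nonneg_left (hTb y) (norm_nonneg _))
  -- comparison of `M` with its first-order approximation `1 - T`
  have hd : ∀ x, HasDerivAt (fun x => star (M x) * (1 - T x)) (star (M x) * (Q x * T x)) x := by
    intro x
    refine ((h.hasDerivAt x).star.mul ((hT' x).const_sub 1)).congr_deriv ?_
    rw [star_mul, hQ.skew]
    noncomm_ring
  have hlim : Tendsto (fun x => star (M x) * (1 - T x)) atTop (𝓝 1) := by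
    simpa using h.tendsto_atTop.star.mul
      (tendsto_const_nhds.sub (tendsto_tailIntegral_atTop hQ.integrable))
  have hint : Integrable fun y => star (M y) * (Q y * T y) :=
    hQT.mono (h.continuous.star.mul (hQ.cont.mul hTc)).aestronglyMeasurable
      (Eventually.of_forall fun y => (h.norm_star_mul hQ y _).le)
  have hI := integral_Ioi_of_hasDerivAt_of_tendsto' (a := x) (fun y _ => hd y)
    hint.integrableOn hlim
  have h2 := Unitary.mul_star_self_of_mem (h.mem_unitary hQ x)
  have hM : M x - 1 = -T x + M x * ∫ y in Ioi x, star (M y) * (Q y * T y) := by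
    rw [hI, mul_sub, ← mul_assoc, h2]
    noncomm_ring
  rw [hM]
  refine (norm_add_le _ _).trans ?_
  rw [norm_neg, CStarRing.norm_mem_unitary_mul _ (h.mem_unitary hQ x)]
  gcongr
  refine norm_integral_le_of_norm_le hQTn.integrableOn (Eventually.of_forall fun y => ?_)
  rw [h.norm_star_mul hQ]
  exact norm_mul_le _ _

end JostProperties

/-! ### Dependence on the spectral parameter -/

section JostFamily

open Filter Topology Set

variable {E : Type*} [CStarAlgebra E]

/-- A family `z ↦ Q z` of skew-adjoint integrable coefficients that is differentiable in the
spectral parameter `z`, with derivative `D z` dominated by an integrable function `k`. -/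
structure IsSkewFamily (Q D : ℝ → ℝ → E) (k : ℝ → ℝ) : Prop where
  skew : ∀ z, IsSkewPotential (Q z)
  hasDerivAt : ∀ z y, HasDerivAt (fun z => Q z y) (D z y) z
  norm_le : ∀ z y, ‖D z y‖ ≤ k y
  aestronglyMeasurable : ∀ z, AEStronglyMeasurable (D z)
  integrable : Integrable k

variable {Q D : ℝ → ℝ → E} {k : ℝ → ℝ}

theorem IsSkewFamily.norm_sub_le (hF : IsSkewFamily Q D k) (z z' y : ℝ) :
    ‖Q z y - Q z' y‖ ≤ k y * |z - z'| := by
  have := Convex.norm_image_sub_le_of_norm_hasDerivWithin_le (s := univ) (C := k y)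
    (f := fun z => Q z y) (f' := fun z => D z y) (x := z') (y := z)
    (fun x _ => (hF.hasDerivAt x y).hasDerivWithinAt) (fun x _ => hF.norm_le x y) convex_univ
    (mem_univ _) (mem_univ _)
  simpa [Real.norm_eq_abs] using this

theorem IsSkewFamily.continuous_tailIntegral (hF : IsSkewFamily Q D k) :
    Continuous fun p : ℝ × ℝ => ∫ y in Ioi p.2, Q p.1 y := by
  have hk0 : ∀ y, 0 ≤ k y := fun y => (norm_nonneg _).trans (hF.norm_le 0 y)
  have hk : 0 ≤ ∫ y, k y := integral_nonneg hk0
  refine continuous_prod_of_continuous_lipschitzWith _ (∫ y, k y).toNNReal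
    (fun z => continuous_iff_continuousAt.2 fun x =>
      (hasDerivAt_tailIntegral (hF.skew z).cont (hF.skew z).integrable x).continuousAt)
    fun x => LipschitzWith.of_dist_le_mul fun z z' => ?_
  rw [dist_eq_norm, Real.dist_eq, Real.coe_toNNReal _ hk]
  dsimp only
  rw [← integral_sub (hF.skew z).integrable.integrableOn (hF.skew z').integrable.integrableOn,
    ← integral_mul_const]
  exact (norm_integral_le_of_norm_le (hF.integrable.mul_const _).integrableOn
    (Eventually.of_forall (hF.norm_sub_le z z'))).trans
    (setIntegral_le_integral (hF.integrable.mul_const _)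
      (Eventually.of_forall fun y => mul_nonneg (hk0 y) (abs_nonneg _)))

variable [IsDedekindFiniteMonoid E] {M : ℝ → ℝ → E}

theorem IsSkewFamily.norm_jost_sub_le (hF : IsSkewFamily Q D k) (hM : ∀ z, IsJost (Q z) (M z))
    (z z' x : ℝ) : ‖M z x - M z' x‖ ≤ (∫ y, k y) * |z - z'| := by
  refine ((hM z).norm_sub_le (hF.skew z) (hF.skew z') (hM z') x).trans ?_
  rw [← integral_mul_const]
  exact integral_mono ((hF.skew z).integrable.sub (hF.skew z').integrable).norm
    (hF.integrable.mul_const _) (hF.norm_sub_le z z')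

/-- Jost solutions are jointly continuous in the spectral parameter and the position. -/
theorem IsSkewFamily.continuous_jost (hF : IsSkewFamily Q D k) (hM : ∀ z, IsJost (Q z) (M z)) :
    Continuous fun p : ℝ × ℝ => M p.1 p.2 := by
  have hk : 0 ≤ ∫ y, k y := integral_nonneg fun y => (norm_nonneg _).trans (hF.norm_le 0 y)
  refine continuous_prod_of_continuous_lipschitzWith _ (∫ y, k y).toNNReal
    (fun z => (hM z).continuous) fun x => LipschitzWith.of_dist_le_mul fun z z' => ?_
  rw [dist_eq_norm, Real.dist_eq, Real.coe_toNNReal _ hk]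
  exact hF.norm_jost_sub_le hM z z' x

/-- The scattering matrix is differentiable in the spectral parameter; by Duhamel's formula its
logarithmic derivative is the integral of the conjugated derivative of the coefficients. -/
theorem IsSkewFamily.hasDerivAt_scatter (hF : IsSkewFamily Q D k)
    (hM : ∀ z, IsJost (Q z) (M z)) (z : ℝ) :
    HasDerivAt (fun z => scatter (Q z) (M z))
      (-(scatter (Q z) (M z) * ∫ y, star (M z y) * D z y * M z y)) z := by
  rw [hasDerivAt_iff_tendsto_slope]
  have hS := (hM z).scatter_mem_unitary (hF.skew z)
  have hslope : ∀ w, w ≠ z → slope (fun z => scatter (Q z) (M z)) z w =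
      -(scatter (Q z) (M z) *
        ∫ y, star (M z y) * ((w - z)⁻¹ • (Q w y - Q z y)) * M w y) := by
    intro w hw
    have h1 := (hM w).duhamel_scatter (hF.skew w) (hF.skew z) (hM z)
    have h2 : (∫ y, star (M z y) * ((w - z)⁻¹ • (Q w y - Q z y)) * M w y) =
        (w - z)⁻¹ • ∫ y, star (M z y) * (Q w y - Q z y) * M w y := by
      rw [← integral_smul]
      refine integral_congr_ae (Eventually.of_forall fun y => ?_)
      simp only [mul_smul_comm, smul_mul_assoc]
    have h3 : (∫ y, star (M z y) * (Q w y - Q z y) * M w y) =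
        1 - star (scatter (Q z) (M z)) * scatter (Q w) (M w) := by rw [h1]; abel
    rw [h2, h3, slope_def_module, mul_smul_comm, mul_sub, ← mul_assoc,
      Unitary.mul_star_self_of_mem hS, ← smul_neg]
    congr 1
    simp
  refine Tendsto.congr' (f₁ := fun w => -(scatter (Q z) (M z) *
        ∫ y, star (M z y) * ((w - z)⁻¹ • (Q w y - Q z y)) * M w y)) ?_ ?_
  · filter_upwards [self_mem_nhdsWithin] with w hw
    exact (hslope w hw).symm
  refine (Tendsto.const_mul _ ?_).neg
  refine tendsto_integral_filter_of_dominated_convergence k ?_ ?_ hF.integrable ?_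
  · refine Eventually.of_forall fun w => ?_
    exact (((hM z).continuous.star.mul
      (((hF.skew w).cont.sub (hF.skew z).cont).const_smul _)).mul
        (hM w).continuous).aestronglyMeasurable
  · filter_upwards [self_mem_nhdsWithin] with w hw
    refine Eventually.of_forall fun y => ?_
    rw [(hM w).norm_mul (hF.skew w), (hM z).norm_star_mul (hF.skew z), norm_smul, norm_inv,
      Real.norm_eq_abs]
    have h0 : 0 < |w - z| := abs_pos.2 (sub_ne_zero.2 hw)
    rw [inv_mul_le_iff₀ h0, mul_comm]
    exact hF.norm_sub_le w z y
  · refine Eventually.of_forall fun y => ?_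
    have h1 : Tendsto (fun w => (w - z)⁻¹ • (Q w y - Q z y)) (𝓝[≠] z) (𝓝 (D z y)) := by
      exact (hasDerivAt_iff_tendsto_slope.1 (hF.hasDerivAt z y)).congr
        fun w => slope_def_module _ _ _
    have h2 : Tendsto (fun w => M w y) (𝓝[≠] z) (𝓝 (M z y)) :=
      (((hF.continuous_jost hM).comp (Continuous.prodMk_left y)).tendsto z).mono_left
        nhdsWithin_le_nhds
    exact (h1.const_mul _).mul h2

end JostFamily

/-! ### Plancherel's theorem for oscillatory integrals -/

section Plancherel

open Filter Topology Set
open scoped FourierTransform SchwartzMap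

/-- On `L¹ ∩ L²` the `L²` Fourier transform is given by the Fourier integral. -/
theorem fourier_toLp_ae_eq {f : ℝ → ℂ} (h1 : Integrable f) (h2 : MemLp f 2 volume) :
    ((𝓕 (h2.toLp f) : Lp ℂ 2 (volume : Measure ℝ)) : ℝ → ℂ) =ᵐ[volume] 𝓕 f := by
  set G : Lp ℂ 2 (volume : Measure ℝ) := 𝓕 (h2.toLp f) with hG
  have hcont : Continuous (𝓕 f) :=
    VectorFourier.fourierIntegral_continuous Real.continuous_fourierChar
      (continuous_inner (𝕜 := ℝ) (E := ℝ)) h1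
  have hl1 : LocallyIntegrable G := (Lp.memLp G).locallyIntegrable (by norm_num)
  have hl2 : LocallyIntegrable (𝓕 f) := hcont.locallyIntegrable
  have key : ∀ᵐ x, (G : ℝ → ℂ) x - 𝓕 f x = 0 := by
    refine ae_eq_zero_of_integral_contDiff_smul_eq_zero (hl1.sub hl2) fun g hg hgc => ?_
    have hg₁ : HasCompactSupport (Complex.ofRealCLM ∘ g) := hgc.comp_left rfl
    have hg₂ : ContDiff ℝ ∞ (Complex.ofRealCLM ∘ g) := by fun_prop
    set φ : 𝓢(ℝ, ℂ) := hg₁.toSchwartzMap hg₂ with hφ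
    have e1 : ∫ x, φ x • G x = ∫ x, (𝓕 φ) x • f x := by
      have := congrArg (fun T => T φ) (Lp.fourier_toTemperedDistribution_eq (h2.toLp f))
      simp only [TemperedDistribution.fourier_apply, Lp.toTemperedDistribution_apply] at this
      rw [← this]
      refine integral_congr_ae ?_
      filter_upwards [h2.coeFn_toLp] with x hx
      rw [hx]
    have e2 : ∫ x, (𝓕 φ) x • f x = ∫ x, φ x • 𝓕 f x := by
      simpa using! (VectorFourier.integral_fourierIntegral_smul_eq_flip (L := innerₗ ℝ)
        Real.continuous_fourierChar continuous_inner φ.integrable h1)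
    have e3 : ∀ x, g x • (G x - 𝓕 f x) = φ x • G x - φ x • 𝓕 f x := by
      intro x
      simp [hφ, mul_sub]
    have i1 : Integrable fun x => φ x • G x := by
      have := hl1.integrable_smul_left_of_hasCompactSupport φ.continuous hg₁
      exact this
    have i2 : Integrable fun x => φ x • 𝓕 f x := by
      have := hl2.integrable_smul_left_of_hasCompactSupport φ.continuous hg₁
      exact this
    simp_rw [e3]
    rw [integral_sub i1 i2, e1, e2, sub_self]
  filter_upwards [key] with x hx
  exact sub_eq_zero.1 hx

theorem eLpNorm_fourier {f : ℝ → ℂ} (h1 : Integrable f) (h2 : MemLp f 2 volume) :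
    eLpNorm (𝓕 f) 2 volume = eLpNorm f 2 volume := by
  have h := Lp.norm_fourier_eq (h2.toLp f)
  rw [Lp.norm_def, Lp.norm_def, ENNReal.toReal_eq_toReal_iff' (Lp.eLpNorm_ne_top _)
    (Lp.eLpNorm_ne_top _)] at h
  rwa [eLpNorm_congr_ae (fourier_toLp_ae_eq h1 h2), eLpNorm_congr_ae h2.coeFn_toLp] at h

/-- Plancherel's theorem for the oscillatory integral with frequency `c z`. -/
theorem eLpNorm_oscillatory {c : ℝ} (hc : c ≠ 0) : ∃ C : NNReal, ∀ f : ℝ → ℂ, Integrable f →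
    MemLp f 2 volume →
    eLpNorm (fun z : ℝ => ∫ y, Complex.exp (-(Complex.I * (z * y * c : ℝ))) * f y) 2 volume ≤
      C * eLpNorm f 2 volume := by
  set b : ℝ := c / (2 * Real.pi) with hb
  have hb0 : b ≠ 0 := div_ne_zero hc (by positivity)
  refine ⟨(ENNReal.ofReal |b⁻¹| ^ (1 / (2 : ENNReal)).toReal).toNNReal, fun f h1 h2 => ?_⟩
  have hcont : Continuous (𝓕 f) :=
    VectorFourier.fourierIntegral_continuous Real.continuous_fourierChar
      (continuous_inner (𝕜 := ℝ) (E := ℝ)) h1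
  have e : (fun z : ℝ => ∫ y, Complex.exp (-(Complex.I * (z * y * c : ℝ))) * f y) =
      (𝓕 f) ∘ fun z => b * z := by
    funext z
    rw [Function.comp, Real.fourier_real_eq_integral_exp_smul]
    refine integral_congr_ae (Eventually.of_forall fun y => ?_)
    simp only [smul_eq_mul]
    congr 2
    rw [hb]
    push_cast
    field_simp
  have hmap := Real.map_volume_mul_left hb0
  rw [e, ← eLpNorm_map_measure (by rw [hmap]; exact hcont.aestronglyMeasurable)
    (by fun_prop), hmap, eLpNorm_smul_measure_of_ne_top (by norm_num), eLpNorm_fourier h1 h2,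
    smul_eq_mul, ENNReal.coe_toNNReal]
  exact ENNReal.rpow_ne_top_of_nonneg (by positivity) ENNReal.ofReal_ne_top

end Plancherel

/-! ### Weak derivatives and primitives -/

section WeakDerivative

open Filter Topology Set

/-- Integration by parts for a primitive `∫ₐ v` of a merely integrable function, by Fubini. -/
theorem integral_primitive_mul_deriv {v h h' : ℝ → ℂ} {a b : ℝ} (hab : a ≤ b)
    (hv : IntervalIntegrable v volume a b) (hh : ∀ x, HasDerivAt h (h' x) x)
    (hh' : Continuous h') :
    ∫ t in a..b, (∫ s in a..t, v s) * h' t =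
      (∫ s in a..b, v s) * h b - ∫ s in a..b, v s * h s := by
  have hv' : Integrable v (volume.restrict (Ioc a b)) :=
    (intervalIntegrable_iff_integrableOn_Ioc_of_le hab).1 hv
  have hi' : Integrable h' (volume.restrict (Ioc a b)) :=
    (intervalIntegrable_iff_integrableOn_Ioc_of_le hab).1 (hh'.intervalIntegrable _ _)
  have hc : Continuous h := continuous_iff_continuousAt.2 fun x => (hh x).continuousAt
  have hmeas : MeasurableSet {p : ℝ × ℝ | p.1 ≤ p.2} :=
    measurableSet_le measurable_fst measurable_snd
  have hF : Integrable ({p : ℝ × ℝ | p.1 ≤ p.2}.indicator fun p => v p.1 * h' p.2)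
      ((volume.restrict (Ioc a b)).prod (volume.restrict (Ioc a b))) :=
    (hv'.mul_prod hi').indicator hmeas
  have hswap := integral_integral_swap (f := fun s t =>
    {p : ℝ × ℝ | p.1 ≤ p.2}.indicator (fun p => v p.1 * h' p.2) (s, t)) hF
  have e1 : ∀ t ∈ Ioc a b, (∫ s in Ioc a b,
      {p : ℝ × ℝ | p.1 ≤ p.2}.indicator (fun p => v p.1 * h' p.2) (s, t)) =
      (∫ s in a..t, v s) * h' t := by
    intro t ht
    have : (fun s => {p : ℝ × ℝ | p.1 ≤ p.2}.indicator (fun p => v p.1 * h' p.2) (s, t)) =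
        (Iic t).indicator fun s => v s * h' t := by
      funext s
      by_cases hs : s ≤ t <;> simp [indicator, hs]
    rw [this, setIntegral_indicator measurableSet_Iic, Ioc_inter_Iic, min_eq_right ht.2,
      integral_mul_const, intervalIntegral.integral_of_le ht.1.le]
  have e2 : ∀ s ∈ Ioc a b, (∫ t in Ioc a b,
      {p : ℝ × ℝ | p.1 ≤ p.2}.indicator (fun p => v p.1 * h' p.2) (s, t)) =
      v s * h b - v s * h s := by
    intro s hs
    have : (fun t => {p : ℝ × ℝ | p.1 ≤ p.2}.indicator (fun p => v p.1 * h' p.2) (s, t)) =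
        (Ici s).indicator fun t => v s * h' t := by
      funext t
      by_cases hs : s ≤ t <;> simp [indicator, hs]
    have hset : Ioc a b ∩ Ici s = Icc s b := by
      ext t
      simp only [mem_inter_iff, mem_Ioc, mem_Ici, mem_Icc]
      exact ⟨fun h => ⟨h.2, h.1.2⟩, fun h => ⟨⟨hs.1.trans_le h.1, h.2⟩, h.1⟩⟩
    rw [this, setIntegral_indicator measurableSet_Ici, hset, integral_const_mul,
      integral_Icc_eq_integral_Ioc, ← intervalIntegral.integral_of_le hs.2,
      intervalIntegral.integral_eq_sub_of_hasDerivAt (fun x _ => hh x)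
        (hh'.intervalIntegrable _ _), mul_sub]
  have hvh : IntervalIntegrable (fun s => v s * h s) volume a b :=
    hv.mul_continuousOn hc.continuousOn
  rw [intervalIntegral.integral_of_le hab, ← setIntegral_congr_fun measurableSet_Ioc e1, ← hswap,
    setIntegral_congr_fun measurableSet_Ioc e2, ← intervalIntegral.integral_of_le hab,
    intervalIntegral.integral_sub (hv.mul_const _) hvh, intervalIntegral.integral_mul_const]

/-- The product rule, in integrated form, for a primitive `p` of a locally integrable function and a
continuously differentiable `h`. -/
theorem integral_deriv_mul_add_mul_deriv {p g h h' : ℝ → ℂ} (hg : LocallyIntegrable g)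
    (hp : ∀ x, p x = p 0 + ∫ t in (0 : ℝ)..x, g t) (hh : ∀ x, HasDerivAt h (h' x) x)
    (hh' : Continuous h') {a b : ℝ} (hab : a ≤ b) :
    ∫ t in a..b, (g t * h t + p t * h' t) = p b * h b - p a * h a := by
  have hgi : ∀ a b, IntervalIntegrable g volume a b := fun a b =>
    (hg.integrableOn_isCompact isCompact_uIcc).intervalIntegrable
  have hc : Continuous h := continuous_iff_continuousAt.2 fun x => (hh x).continuousAt
  have hpa : ∀ t, p t = p a + ∫ s in a..t, g s := by
    intro t
    rw [hp t, hp a, ← intervalIntegral.integral_add_adjacent_intervals (hgi 0 a) (hgi a t)]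
    ring
  have hprim : Continuous fun t => ∫ s in a..t, g s :=
    intervalIntegral.continuous_primitive hgi a
  have e : ∀ t, g t * h t + p t * h' t =
      g t * h t + (p a * h' t + (∫ s in a..t, g s) * h' t) := by
    intro t
    rw [hpa t]
    ring
  have c1 : Continuous fun t => p a * h' t := continuous_const.mul hh'
  have c2 : Continuous fun t => (∫ s in a..t, g s) * h' t := hprim.mul hh'
  have c3 : Continuous fun t => p a * h' t + (∫ s in a..t, g s) * h' t := c1.add c2
  simp_rw [e]
  rw [intervalIntegral.integral_add ((hgi a b).mul_continuousOn hc.continuousOn)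
      (c3.intervalIntegrable _ _),
    intervalIntegral.integral_add (c1.intervalIntegrable _ _) (c2.intervalIntegrable _ _),
    integral_primitive_mul_deriv hab (hgi a b) hh hh', intervalIntegral.integral_const_mul,
    intervalIntegral.integral_eq_sub_of_hasDerivAt (fun x _ => hh x)
        (hh'.intervalIntegrable _ _), hpa b]
  ring

theorem exists_Icc_of_hasCompactSupport {φ : ℝ → ℝ} (hφ : HasCompactSupport φ) :
    ∃ R : ℝ, 0 < R ∧ ∀ x, R ≤ |x| → φ x = 0 := by
  obtain ⟨R, hR⟩ := hφ.isCompact.isBounded.subset_ball 0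
  refine ⟨max R 1, by positivity, fun x hx => ?_⟩
  by_contra h
  have := hR (subset_tsupport φ h)
  rw [Metric.mem_ball, Real.dist_eq, sub_zero] at this
  exact absurd (le_max_left R 1) (by linarith)

theorem integral_eq_intervalIntegral_of_eq_zero {F : Type*} [NormedAddCommGroup F] [NormedSpace ℝ F]
    {f : ℝ → F} {R : ℝ} (h : ∀ x, R ≤ |x| → f x = 0) :
    ∫ x, f x = ∫ x in (-R)..R, f x := by
  symm
  refine intervalIntegral.integral_eq_integral_of_support_subset fun x hx => ?_
  by_contra hn
  apply hx
  apply h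
  by_contra hlt
  rw [not_le, abs_lt] at hlt
  exact hn ⟨hlt.1, hlt.2.le⟩

/-- The lemma of du Bois-Reymond: a locally integrable function whose distributional derivative
vanishes is almost everywhere constant. -/
theorem ae_eq_const_of_integral_deriv_smul_eq_zero {u : ℝ → ℂ} (hu : LocallyIntegrable u)
    (h : ∀ φ : ℝ → ℝ, ContDiff ℝ ∞ φ → HasCompactSupport φ → ∫ x, deriv φ x • u x = 0) :
    ∃ c : ℂ, ∀ᵐ x, u x = c := by
  -- `u` equals its average against a fixed test function `ψ` of integral one
  let B : ContDiffBump (0 : ℝ) := ⟨1, 2, by norm_num, by norm_num⟩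
  set ψ : ℝ → ℝ := B.normed volume with hψ
  have hψs : ContDiff ℝ ∞ ψ := B.contDiff_normed
  have hψc : HasCompactSupport ψ := B.hasCompactSupport_normed
  have hψ1 : ∫ x, ψ x = 1 := B.integral_normed
  refine ⟨∫ x, ψ x • u x, ?_⟩
  have key : ∀ᵐ x, u x - ∫ x, ψ x • u x = 0 := by
    refine ae_eq_zero_of_integral_contDiff_smul_eq_zero (hu.sub (locallyIntegrable_const _))
      fun φ hφ hφc => ?_
    set m := ∫ x, φ x with hm
    -- `χ` has integral zero, hence is the derivative of a test function
    set χ : ℝ → ℝ := fun x => φ x - m * ψ x with hχ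
    have hχs : ContDiff ℝ ∞ χ := hφ.sub (contDiff_const.mul hψs)
    have hχc : HasCompactSupport χ := hφc.sub (hψc.mul_left)
    have hφi : Integrable φ := hφ.continuous.integrable_of_hasCompactSupport hφc
    have hψi : Integrable ψ := hψs.continuous.integrable_of_hasCompactSupport hψc
    have hχ0 : ∫ x, χ x = 0 := by
      rw [hχ, integral_sub hφi (hψi.const_mul m), integral_const_mul, hψ1, mul_one, sub_self]
    obtain ⟨R, hR0, hR⟩ := exists_Icc_of_hasCompactSupport hχc
    set Φ : ℝ → ℝ := fun x => ∫ t in (-R)..x, χ t with hΦ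
    have hΦd : ∀ x, HasDerivAt Φ (χ x) x := fun x =>
      intervalIntegral.integral_hasDerivAt_right (hχs.continuous.intervalIntegrable _ _)
        (hχs.continuous.stronglyMeasurableAtFilter _ _) hχs.continuous.continuousAt
    have hderiv : deriv Φ = χ := funext fun x => (hΦd x).deriv
    have hΦs : ContDiff ℝ ∞ Φ :=
      contDiff_infty_iff_deriv.2 ⟨fun x => (hΦd x).differentiableAt, by rwa [hderiv]⟩
    have hΦc : HasCompactSupport Φ := by
      refine HasCompactSupport.intro (isCompact_Icc (a := -R) (b := R)) fun x hx => ?_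
      rcases lt_or_ge x (-R) with h1 | h1
      · rw [hΦ]
        refine intervalIntegral.integral_zero_ae (Eventually.of_forall fun t ht => hR t ?_)
        rw [uIoc_of_ge h1.le] at ht
        exact (by linarith [ht.2] : R ≤ -t).trans (neg_le_abs t)
      · have h2 : R < x := by
          by_contra h3
          exact hx ⟨h1, not_lt.1 h3⟩
        have h3 : ∫ t in R..x, χ t = 0 := by
          refine intervalIntegral.integral_zero_ae (Eventually.of_forall fun t ht => hR t ?_)
          rw [uIoc_of_le h2.le] at ht
          exact ht.1.le.trans (le_abs_self t)
        change ∫ t in (-R)..x, χ t = 0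
        rw [← intervalIntegral.integral_add_adjacent_intervals
          (hχs.continuous.intervalIntegrable (-R) R) (hχs.continuous.intervalIntegrable R x), h3,
          ← integral_eq_intervalIntegral_of_eq_zero hR, hχ0, add_zero]
    have h0 := h Φ hΦs hΦc
    rw [hderiv] at h0
    have i1 : Integrable fun x => φ x • u x :=
      hu.integrable_smul_left_of_hasCompactSupport hφ.continuous hφc
    have i2 : Integrable fun x => ψ x • u x :=
      hu.integrable_smul_left_of_hasCompactSupport hψs.continuous hψc
    have e1 : ∀ x, χ x • u x = φ x • u x - m • (ψ x • u x) := by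
      intro x
      simp only [hχ, sub_smul, mul_smul]
    simp_rw [e1] at h0
    have i3 : Integrable fun x => m • (ψ x • u x) := i2.smul m
    rw [integral_sub i1 i3, integral_smul] at h0
    simp_rw [smul_sub]
    rw [integral_sub i1 (hφi.smul_const _), integral_smul_const]
    exact h0
  filter_upwards [key] with x hx
  exact sub_eq_zero.1 hx

/-- A function with a locally integrable weak derivative `g` agrees almost everywhere with a
primitive of `g`. -/
theorem exists_primitive_of_isWeakDeriv {f g : ℝ → ℂ} (hf : LocallyIntegrable f)
    (hg : LocallyIntegrable g) (h : IsWeakDerivOfOrder 1 f g) :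
    ∃ c : ℂ, ∀ᵐ x, f x = c + ∫ t in (0 : ℝ)..x, g t := by
  have hgi : ∀ a b, IntervalIntegrable g volume a b := fun a b =>
    (hg.integrableOn_isCompact isCompact_uIcc).intervalIntegrable
  set G : ℝ → ℂ := fun x => ∫ t in (0 : ℝ)..x, g t with hG
  have hGc : Continuous G := intervalIntegral.continuous_primitive hgi 0
  obtain ⟨c, hc⟩ := ae_eq_const_of_integral_deriv_smul_eq_zero (u := fun x => f x - G x)
    (hf.sub hGc.locallyIntegrable) (by
      intro φ hφ hφc
      have hφ' : Continuous (deriv φ) := hφ.continuous_deriv (by norm_num)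
      have hφ'c : HasCompactSupport (deriv φ) := hφc.deriv
      have h1 := h φ hφ hφc
      rw [iteratedDeriv_one, pow_one, neg_one_mul] at h1
      obtain ⟨R, hR0, hR⟩ := exists_Icc_of_hasCompactSupport hφc
      obtain ⟨R', hR0', hR'⟩ := exists_Icc_of_hasCompactSupport hφ'c
      set T := max R R'
      have hT0 : 0 < T := lt_max_of_lt_left hR0
      have hT : ∀ x, T ≤ |x| → φ x = 0 := fun x hx => hR x ((le_max_left _ _).trans hx)
      have hT' : ∀ x, T ≤ |x| → deriv φ x = 0 := fun x hx => hR' x ((le_max_right _ _).trans hx)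
      have h2 := integral_deriv_mul_add_mul_deriv (p := G) (g := g) (h := fun x => (φ x : ℂ))
        (h' := fun x => ((deriv φ x : ℝ) : ℂ)) hg (by simp [hG])
        (fun x => ((hφ.differentiable (by norm_num)) x).hasDerivAt.ofReal_comp)
        (Complex.continuous_ofReal.comp hφ') (by linarith : -T ≤ T)
      rw [hT T (le_abs_self T), hT (-T) (by rw [abs_neg]; exact le_abs_self T)] at h2
      have i1 : Integrable fun x => deriv φ x • f x :=
        hf.integrable_smul_left_of_hasCompactSupport hφ' hφ'c
      have i2 : Integrable fun x => deriv φ x • G x :=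
        hGc.locallyIntegrable.integrable_smul_left_of_hasCompactSupport hφ' hφ'c
      have i3 : Integrable fun x => φ x • g x :=
        hg.integrable_smul_left_of_hasCompactSupport hφ.continuous hφc
      simp_rw [smul_sub]
      rw [integral_sub i1 i2, h1]
      have e3 : ∫ x, (φ x • g x + deriv φ x • G x) = 0 := by
        rw [integral_eq_intervalIntegral_of_eq_zero (fun x hx => by simp [hT x hx, hT' x hx])]
        simp only [Complex.ofReal_zero, mul_zero, sub_zero] at h2
        rw [← h2]
        congr 1
        funext x
        simp only [Complex.real_smul]
        ring
      rw [integral_add i3 i2] at e3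
      linear_combination -e3)
  refine ⟨c, ?_⟩
  filter_upwards [hc] with x hx
  linear_combination hx

/-- The classical derivative is a weak derivative. -/
theorem isWeakDeriv_of_hasDerivAt {f g : ℝ → ℂ} (hg : LocallyIntegrable g)
    (h : ∀ x, HasDerivAt f (g x) x) : IsWeakDerivOfOrder 1 f g := by
  intro φ hφ hφc
  have hf : Continuous f := continuous_iff_continuousAt.2 fun x => (h x).continuousAt
  have hφ' : Continuous (deriv φ) := hφ.continuous_deriv (by norm_num)
  have i3 : Integrable fun x => φ x • g x :=
    hg.integrable_smul_left_of_hasCompactSupport hφ.continuous hφc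
  have i2 : Integrable fun x => deriv φ x • f x :=
    hf.locallyIntegrable.integrable_smul_left_of_hasCompactSupport hφ' hφc.deriv
  have i1 : Integrable fun x => φ x • f x :=
    hf.locallyIntegrable.integrable_smul_left_of_hasCompactSupport hφ.continuous hφc
  rw [iteratedDeriv_one, pow_one, neg_one_mul]
  have := integral_bilinear_hasDerivAt_right_eq_neg_left_of_integrable
    (L := ContinuousLinearMap.lsmul ℝ ℝ) (u := φ) (v := f) (u' := deriv φ) (v' := g)
    (fun x _ => ((hφ.differentiable (by norm_num)) x).hasDerivAt) (fun x _ => h x) i3 i2 i1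
  simp only [ContinuousLinearMap.lsmul_apply] at this
  rw [this, neg_neg]

end WeakDerivative

/-! ### Continuous representatives in the weighted Sobolev space -/

section WeightedSobolev

open Filter Topology Set

/-- `p` is the continuous representative of an element of `H^{1,2}(ℝ)`: it is a primitive of the
square-integrable function `g`, and `(1 + x²) p` is square integrable. -/
structure IsSobolevRep (p g : ℝ → ℂ) : Prop where
  primitive : ∀ x, p x = p 0 + ∫ t in (0 : ℝ)..x, g t
  memLp_deriv : MemLp g 2 volume
  memLp_weight : MemLp (fun x : ℝ => (1 + x ^ 2) • p x) 2 volume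

variable {p g : ℝ → ℂ}

theorem IsSobolevRep.locallyIntegrable_deriv (h : IsSobolevRep p g) : LocallyIntegrable g :=
  h.memLp_deriv.locallyIntegrable (by norm_num)

theorem IsSobolevRep.intervalIntegrable_deriv (h : IsSobolevRep p g) (a b : ℝ) :
    IntervalIntegrable g volume a b :=
  (h.locallyIntegrable_deriv.integrableOn_isCompact isCompact_uIcc).intervalIntegrable

theorem IsSobolevRep.sub_eq (h : IsSobolevRep p g) (a b : ℝ) :
    p b - p a = ∫ t in a..b, g t := by
  rw [h.primitive b, h.primitive a, ← intervalIntegral.integral_add_adjacent_intervals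
    (h.intervalIntegrable_deriv 0 a) (h.intervalIntegrable_deriv a b)]
  ring

theorem IsSobolevRep.continuous (h : IsSobolevRep p g) : Continuous p := by
  rw [show p = fun x => p 0 + ∫ t in (0 : ℝ)..x, g t from funext h.primitive]
  exact continuous_const.add
    (intervalIntegral.continuous_primitive h.intervalIntegrable_deriv 0)

theorem IsSobolevRep.memLp_mul (h : IsSobolevRep p g) {c : ℝ → ℝ} (hc : Continuous c)
    (hb : ∀ x, |c x| ≤ 1 + x ^ 2) : MemLp (fun x => (c x : ℂ) * p x) 2 volume := by
  refine h.memLp_weight.mono ((Complex.continuous_ofReal.comp hc).mul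
    h.continuous).aestronglyMeasurable (Eventually.of_forall fun x => ?_)
  rw [norm_mul, norm_smul, Complex.norm_real, Real.norm_eq_abs, Real.norm_eq_abs,
    abs_of_pos (by positivity : 0 < 1 + x ^ 2)]
  exact mul_le_mul_of_nonneg_right (hb x) (norm_nonneg _)

theorem IsSobolevRep.memLp (h : IsSobolevRep p g) : MemLp p 2 volume := by
  simpa using h.memLp_mul (c := fun _ => 1) continuous_const fun x => by
    simp only [abs_one]; nlinarith [sq_nonneg x]

/-- Cauchy–Schwarz, as `(1 + |x|) / (1 + x²)` is square integrable. -/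
theorem IsSobolevRep.integrable_weight (h : IsSobolevRep p g) :
    Integrable fun x => (((1 + |x| : ℝ)) : ℂ) * p x := by
  have h1 : MemLp (fun x : ℝ => (((1 + |x|) * (1 + x ^ 2)⁻¹ : ℝ) : ℂ)) 2 volume := by
    have hcont : Continuous fun x : ℝ => (1 + |x|) * (1 + x ^ 2)⁻¹ :=
      (continuous_const.add continuous_abs).mul
        ((continuous_const.add (continuous_pow 2)).inv₀ fun x =>
          (by positivity : (0 : ℝ) < 1 + x ^ 2).ne')
    have hcont' := Complex.continuous_ofReal.comp hcont
    refine (memLp_two_iff_integrable_sq_norm hcont'.aestronglyMeasurable).2 ?_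
    refine (integrable_inv_one_add_sq.const_mul 2).mono'
      (hcont'.norm.pow 2).aestronglyMeasurable (Eventually.of_forall fun x => ?_)
    rw [Function.comp]
    rw [Complex.norm_real, norm_pow, norm_norm, Real.norm_eq_abs, sq_abs, mul_pow]
    have h0 : (0 : ℝ) < 1 + x ^ 2 := by positivity
    have h1 : (1 + |x|) ^ 2 ≤ 2 * (1 + x ^ 2) := by nlinarith [sq_nonneg (1 - |x|), sq_abs x]
    calc (1 + |x|) ^ 2 * ((1 + x ^ 2)⁻¹) ^ 2 ≤ 2 * (1 + x ^ 2) * ((1 + x ^ 2)⁻¹) ^ 2 := by gcongr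
      _ = 2 * (1 + x ^ 2)⁻¹ := by field_simp
  refine (h1.integrable_mul h.memLp_weight).congr (Eventually.of_forall fun x => ?_)
  have h0 : ((1 : ℂ) + (x : ℂ) ^ 2) ≠ 0 := by
    have : (0 : ℝ) < 1 + x ^ 2 := by positivity
    exact_mod_cast this.ne'
  simp only [Pi.mul_apply, Complex.real_smul]
  push_cast
  field_simp

theorem IsSobolevRep.integrable (h : IsSobolevRep p g) : Integrable p := by
  refine h.integrable_weight.mono h.continuous.aestronglyMeasurable
    (Eventually.of_forall fun x => ?_)
  rw [norm_mul, Complex.norm_real, Real.norm_eq_abs, abs_of_pos (by positivity)]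
  exact le_mul_of_one_le_left (norm_nonneg _) (by linarith [abs_nonneg x])

theorem IsSobolevRep.integrable_id_mul (h : IsSobolevRep p g) :
    Integrable fun x : ℝ => (x : ℂ) * p x := by
  refine h.integrable_weight.mono
    (Complex.continuous_ofReal.mul h.continuous).aestronglyMeasurable
    (Eventually.of_forall fun x => ?_)
  rw [norm_mul, norm_mul, Complex.norm_real, Complex.norm_real, Real.norm_eq_abs,
    Real.norm_eq_abs, abs_of_pos (by positivity : 0 < 1 + |x|)]
  exact mul_le_mul_of_nonneg_right (by linarith) (norm_nonneg _)

theorem tendsto_integral_unit_interval {k : ℝ → ℝ} (hk : Integrable k) :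
    Tendsto (fun x => ∫ t in x..(x + 1), k t) atTop (𝓝 0) ∧
    Tendsto (fun x => ∫ t in x..(x + 1), k t) atBot (𝓝 0) := by
  have e : ∀ x, ∫ t in x..(x + 1), k t = (∫ t in (0 : ℝ)..(x + 1), k t) - ∫ t in (0 : ℝ)..x, k t :=
    fun x => (intervalIntegral.integral_interval_sub_left hk.intervalIntegrable
      hk.intervalIntegrable).symm
  simp_rw [e]
  constructor
  · have h := intervalIntegral_tendsto_integral_Ioi 0 hk.integrableOn tendsto_id
    have h' := h.comp (tendsto_atTop_add_const_right atTop (1 : ℝ) tendsto_id)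
    simpa using h'.sub h
  · have h := (intervalIntegral_tendsto_integral_Iic 0 hk.integrableOn tendsto_id).neg
    simp_rw [← intervalIntegral.integral_symm] at h
    have h' := h.comp (tendsto_atBot_add_const_right atBot (1 : ℝ) tendsto_id)
    simpa using h'.sub h

/-- Averaging `p x = p y - ∫ₓʸ g` over `y ∈ [x, x + 1]`. -/
theorem IsSobolevRep.norm_le (h : IsSobolevRep p g) (x : ℝ) :
    ‖p x‖ ≤ (∫ t in x..(x + 1), ‖p t‖) + √(∫ t in x..(x + 1), ‖g t‖ ^ 2) := by
  have hx : x ≤ x + 1 := by linarith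
  have hgi := (h.intervalIntegrable_deriv x (x + 1)).norm
  have hg2 : IntervalIntegrable (fun t => ‖g t‖ ^ 2) volume x (x + 1) :=
    ((memLp_two_iff_integrable_sq_norm h.memLp_deriv.1).1 h.memLp_deriv).intervalIntegrable
  set m := ∫ t in x..(x + 1), ‖g t‖ with hm
  have hCS : m ≤ √(∫ t in x..(x + 1), ‖g t‖ ^ 2) := by
    apply Real.le_sqrt_of_sq_le
    have h0 : 0 ≤ ∫ t in x..(x + 1), (‖g t‖ ^ 2 - 2 * m * ‖g t‖ + m ^ 2) :=
      intervalIntegral.integral_nonneg hx fun t _ => by nlinarith [sq_nonneg (‖g t‖ - m)]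
    -- `m` is the mean of `‖g‖` over a unit interval, so this is `∫ ‖g‖² - m² ≥ 0`
    rw [intervalIntegral.integral_add (hg2.sub (hgi.const_mul _)) (by simp),
      intervalIntegral.integral_sub hg2 (hgi.const_mul _),
      intervalIntegral.integral_const_mul, ← hm] at h0
    simp at h0
    nlinarith
  have hle : ∀ y ∈ Icc x (x + 1), ‖p x‖ ≤ ‖p y‖ + m := by
    intro y hy
    have e : p x = p y - ∫ t in x..y, g t := by rw [← h.sub_eq]; ring
    rw [e]
    refine (norm_sub_le _ _).trans ?_
    gcongr
    refine (intervalIntegral.norm_integral_le_integral_norm hy.1).trans ?_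
    exact intervalIntegral.integral_mono_interval le_rfl hy.1 hy.2
      (Eventually.of_forall fun t => norm_nonneg _) hgi
  have hint := intervalIntegral.integral_mono_on (μ := volume) hx
    (f := fun _ => ‖p x‖) (g := fun y => ‖p y‖ + m) (by simp)
    ((h.continuous.norm.add continuous_const).intervalIntegrable _ _) hle
  rw [intervalIntegral.integral_add (h.continuous.norm.intervalIntegrable _ _) (by simp)] at hint
  simp at hint
  linarith

theorem IsSobolevRep.tendsto_zero (h : IsSobolevRep p g) :
    Tendsto p atTop (𝓝 0) ∧ Tendsto p atBot (𝓝 0) := by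
  have hg2 : Integrable fun t => ‖g t‖ ^ 2 :=
    (memLp_two_iff_integrable_sq_norm h.memLp_deriv.1).1 h.memLp_deriv
  have h1 := tendsto_integral_unit_interval h.integrable.norm
  have h2 := tendsto_integral_unit_interval hg2
  constructor
  · have := h1.1.add ((Real.continuous_sqrt.tendsto 0).comp h2.1)
    exact squeeze_zero_norm h.norm_le (by simpa using this)
  · have := h1.2.add ((Real.continuous_sqrt.tendsto 0).comp h2.2)
    exact squeeze_zero_norm h.norm_le (by simpa using this)

theorem IsSobolevRep.bounded (h : IsSobolevRep p g) : ∃ C, ∀ x, ‖p x‖ ≤ C := by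
  have hg2 : Integrable fun t => ‖g t‖ ^ 2 :=
    (memLp_two_iff_integrable_sq_norm h.memLp_deriv.1).1 h.memLp_deriv
  refine ⟨(∫ t, ‖p t‖) + √(∫ t, ‖g t‖ ^ 2), fun x => (h.norm_le x).trans ?_⟩
  have hx : x ≤ x + 1 := by linarith
  rw [intervalIntegral.integral_of_le hx, intervalIntegral.integral_of_le hx]
  exact add_le_add
    (setIntegral_le_integral h.integrable.norm (Eventually.of_forall fun t => norm_nonneg _))
    (Real.sqrt_le_sqrt (setIntegral_le_integral hg2 (Eventually.of_forall fun t => by positivity)))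

theorem IsSobolevRep.const_mul (h : IsSobolevRep p g) (c : ℂ) :
    IsSobolevRep (fun x => c * p x) fun x => c * g x where
  primitive x := by
    rw [intervalIntegral.integral_const_mul, h.primitive x]
    ring
  memLp_deriv := h.memLp_deriv.const_mul c
  memLp_weight := by
    refine (h.memLp_weight.const_mul c).ae_eq (Eventually.of_forall fun x => ?_)
    simp only [Complex.real_smul]
    ring

theorem IsSobolevRep.conj (h : IsSobolevRep p g) :
    IsSobolevRep (fun x => (starRingEnd ℂ) (p x)) fun x => (starRingEnd ℂ) (g x) where
  primitive x := by
    rw [h.primitive x, map_add]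
    congr 1
    simp only [intervalIntegral, integral_conj, map_sub]
  memLp_deriv := h.memLp_deriv.star
  memLp_weight := by
    refine h.memLp_weight.star.ae_eq (Eventually.of_forall fun x => ?_)
    simp [Complex.real_smul]

theorem IsSobolevRep.comp_neg (h : IsSobolevRep p g) :
    IsSobolevRep (fun x => -p (-x)) fun x => g (-x) where
  primitive x := by
    rw [intervalIntegral.integral_comp_neg, intervalIntegral.integral_symm, ← h.sub_eq, neg_zero]
    ring
  memLp_deriv := h.memLp_deriv.comp_measurePreserving (Measure.measurePreserving_neg volume)
  memLp_weight := by
    have := (h.memLp_weight.comp_measurePreserving (Measure.measurePreserving_neg volume)).neg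
    refine this.ae_eq (Eventually.of_forall fun x => ?_)
    simp

theorem isSobolevRep_zero : IsSobolevRep (fun _ => 0) fun _ => 0 where
  primitive := by simp
  memLp_deriv := MemLp.zero
  memLp_weight := by simp

/-- Decay of the `L²` norm of the tails. -/
theorem eLpNorm_tail_le (p : ℝ → ℂ) {y : ℝ} (hy : 0 ≤ y) :
    eLpNorm ((Ioi y).indicator p) 2 volume ≤
      ENNReal.ofReal (1 + y ^ 2)⁻¹ * eLpNorm (fun x : ℝ => (1 + x ^ 2) • p x) 2 volume := by
  refine eLpNorm_le_mul_eLpNorm_of_ae_le_mul (Eventually.of_forall fun x => ?_) 2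
  by_cases hx : x ∈ Ioi y
  · rw [indicator_of_mem hx, norm_smul, Real.norm_eq_abs,
      abs_of_pos (by positivity : 0 < 1 + x ^ 2), ← mul_assoc]
    refine le_mul_of_one_le_left (norm_nonneg _) ?_
    rw [inv_mul_eq_div, one_le_div (by positivity)]
    have : y < x := hx
    nlinarith
  · rw [indicator_of_notMem hx, norm_zero]
    positivity

/-- Every element of `H^{1,2}(ℝ)` has a continuous representative. -/
theorem exists_isSobolevRep {f : ℝ → ℂ} (hf : MemWeightedSobolev 1 2 f) :
    ∃ p g, IsSobolevRep p g ∧ f =ᵐ[volume] p := by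
  obtain ⟨h1, h2, h3⟩ := hf
  obtain ⟨g, hg, hw⟩ := h3 1 le_rfl le_rfl
  obtain ⟨c, hc⟩ := exists_primitive_of_isWeakDeriv (h1.locallyIntegrable (by norm_num))
    (hg.locallyIntegrable (by norm_num)) hw
  refine ⟨fun x => c + ∫ t in (0 : ℝ)..x, g t, g, ⟨by simp, hg, ?_⟩, hc⟩
  refine h2.ae_eq ?_
  filter_upwards [hc] with x hx
  rw [hx]
  congr 1
  rw [show (2 : ℝ) = ((2 : ℕ) : ℝ) by norm_num, Real.rpow_natCast, sq_abs]

end WeightedSobolev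

/-! ### Matrix entries and the operator norm -/

section MatrixPotential

open Filter Topology Set
open scoped Matrix.Norms.L2Operator

local notation "Mat" => Matrix (Fin 3) (Fin 3) ℂ

theorem norm_entry_le (A : Mat) (i j : Fin 3) : ‖A i j‖ ≤ ‖A‖ := by
  have h := Matrix.l2_opNorm_mulVec A (EuclideanSpace.single j (1 : ℂ))
  rw [PiLp.norm_single, norm_one, mul_one] at h
  refine le_trans (le_of_eq ?_) ((PiLp.norm_apply_le _ i).trans h)
  simp

theorem norm_single_le (i j : Fin 3) (c : ℂ) : ‖(Matrix.single i j c : Mat)‖ ≤ ‖c‖ := by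
  have h : ‖(Matrix.single i j c : Mat)‖ * ‖(Matrix.single i j c : Mat)‖ ≤ ‖c‖ * ‖c‖ := by
    rw [← Matrix.l2_opNorm_conjTranspose_mul_self, Matrix.conjTranspose_single,
      Matrix.single_mul_single_same, ← Matrix.diagonal_single, Matrix.l2_opNorm_diagonal,
      Pi.norm_single]
    simp
  exact (mul_self_le_mul_self_iff (norm_nonneg _) (norm_nonneg _)).2 h

theorem norm_le_sum_entry (A : Mat) : ‖A‖ ≤ ∑ i, ∑ j, ‖A i j‖ := by
  conv_lhs => rw [Matrix.matrix_eq_sum_single A]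
  exact (norm_sum_le _ _).trans (Finset.sum_le_sum fun i _ => (norm_sum_le _ _).trans
    (Finset.sum_le_sum fun j _ => norm_single_le i j _))

/-- The matrix entry `A ↦ A i j` as a continuous linear functional. -/
noncomputable def entryCLM (i j : Fin 3) : Mat →L[ℂ] ℂ :=
  LinearMap.toContinuousLinearMap (Matrix.entryLinearMap ℂ ℂ i j)

theorem entryCLM_apply (i j : Fin 3) (A : Mat) : entryCLM i j A = A i j := rfl

theorem hasDerivAt_matrix {A : ℝ → Mat} {A' : Mat} {x : ℝ}
    (h : ∀ i j, HasDerivAt (fun x => A x i j) (A' i j) x) : HasDerivAt A A' x := by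
  have e : ∀ B : Mat, B = ∑ i, ∑ j, B i j • (Matrix.single i j 1 : Mat) := fun B => by
    conv_lhs => rw [Matrix.matrix_eq_sum_single B]
    simp [Matrix.smul_single]
  rw [show A = fun x => ∑ i, ∑ j, A x i j • (Matrix.single i j 1 : Mat) from
    funext fun x => e (A x), e A']
  exact HasDerivAt.fun_sum fun i _ => HasDerivAt.fun_sum fun j _ => (h i j).smul_const _

section Measure

variable {α : Type*} [MeasurableSpace α] {μ : Measure α}

theorem integral_entry {A : α → Mat} (h : Integrable A μ) (i j : Fin 3) :
    (∫ x, A x ∂μ) i j = ∫ x, A x i j ∂μ :=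
  ((entryCLM i j).integral_comp_comm h).symm

theorem aestronglyMeasurable_entry {A : α → Mat} (h : AEStronglyMeasurable A μ) (i j : Fin 3) :
    AEStronglyMeasurable (fun x => A x i j) μ :=
  (entryCLM i j).continuous.comp_aestronglyMeasurable h

theorem aestronglyMeasurable_matrix {A : α → Mat}
    (h : ∀ i j, AEStronglyMeasurable (fun x => A x i j) μ) : AEStronglyMeasurable A μ := by
  have : A = fun x => ∑ i, ∑ j, A x i j • (Matrix.single i j 1 : Mat) := by
    funext x
    conv_lhs => rw [Matrix.matrix_eq_sum_single (A x)]
    simp [Matrix.smul_single]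
  rw [this]
  exact Finset.aestronglyMeasurable_fun_sum _ fun i _ =>
    Finset.aestronglyMeasurable_fun_sum _ fun j _ => (h i j).smul_const _

theorem eLpNorm_matrix_le {A : α → Mat} (h : AEStronglyMeasurable A μ) :
    eLpNorm A 2 μ ≤ ∑ i, ∑ j, eLpNorm (fun x => A x i j) 2 μ := by
  have h1 : eLpNorm A 2 μ ≤ eLpNorm (fun x => ∑ i, ∑ j, ‖A x i j‖) 2 μ :=
    eLpNorm_mono_real fun x => norm_le_sum_entry (A x)
  refine h1.trans ?_
  have hm : ∀ i j, AEStronglyMeasurable (fun x => ‖A x i j‖) μ := fun i j =>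
    (aestronglyMeasurable_entry h i j).norm
  have e1 : (fun x => ∑ i, ∑ j, ‖A x i j‖) = ∑ i, ∑ j, fun x => ‖A x i j‖ := by
    funext x
    simp [Finset.sum_apply]
  rw [e1]
  refine (eLpNorm_sum_le (fun i _ => ?_) (by norm_num)).trans (Finset.sum_le_sum fun i _ => ?_)
  · exact Finset.aestronglyMeasurable_sum _ fun j _ => hm i j
  · refine (eLpNorm_sum_le (fun j _ => hm i j) (by norm_num)).trans
      (Finset.sum_le_sum fun j _ => ?_)
    rw [eLpNorm_norm]

theorem memLp_matrix {A : α → Mat} (h : ∀ i j, MemLp (fun x => A x i j) 2 μ) : MemLp A 2 μ := by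
  have hm := aestronglyMeasurable_matrix fun i j => (h i j).1
  refine ⟨hm, (eLpNorm_matrix_le hm).trans_lt ?_⟩
  exact ENNReal.sum_lt_top.2 fun i _ => ENNReal.sum_lt_top.2 fun j _ => (h i j).2

theorem memLp_entry {A : α → Mat} (h : MemLp A 2 μ) (i j : Fin 3) :
    MemLp (fun x => A x i j) 2 μ :=
  h.mono (aestronglyMeasurable_entry h.1 i j) (Eventually.of_forall fun _ => norm_entry_le _ i j)

theorem integrable_matrix {A : α → Mat} (h : ∀ i j, Integrable (fun x => A x i j) μ) :
    Integrable A μ :=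
  (integrable_finsetSum Finset.univ fun i _ => integrable_finsetSum Finset.univ fun j _ =>
    (h i j).norm).mono' (aestronglyMeasurable_matrix fun i j => (h i j).1)
    (Eventually.of_forall fun x => norm_le_sum_entry (A x))

end Measure

/-! ### Conjugation by the diagonal phases -/

/-- The diagonal unitary matrix `e^{iθA}`. -/
noncomputable def phase (a : Fin 3 → ℝ) (θ : ℝ) : Mat :=
  Matrix.diagonal fun i => Complex.exp (Complex.I * θ * a i)

theorem star_phase (a : Fin 3 → ℝ) (θ : ℝ) :
    star (phase a θ) = Matrix.diagonal fun i => Complex.exp (-(Complex.I * θ * a i)) := by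
  rw [phase, Matrix.star_eq_conjTranspose, Matrix.diagonal_conjTranspose]
  congr 1
  funext i
  simp [← Complex.exp_conj]

theorem phase_mem_unitary (a : Fin 3 → ℝ) (θ : ℝ) : phase a θ ∈ unitary Mat := by
  rw [Unitary.mem_iff, star_phase, phase, Matrix.diagonal_mul_diagonal,
    Matrix.diagonal_mul_diagonal]
  simp [← Complex.exp_add]

theorem expHat_eq (a : Fin 3 → ℝ) (θ : ℝ) (X : Mat) :
    expHat a θ X = phase a θ * X * star (phase a θ) := by
  rw [star_phase]; rfl

theorem expHat_apply (a : Fin 3 → ℝ) (θ : ℝ) (X : Mat) (i j : Fin 3) :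
    expHat a θ X i j = Complex.exp (Complex.I * (θ * (a i - a j) : ℝ)) * X i j := by
  rw [expHat, Matrix.mul_diagonal, Matrix.diagonal_mul, mul_right_comm, ← Complex.exp_add]
  congr 2
  push_cast
  ring

theorem norm_expHat (a : Fin 3 → ℝ) (θ : ℝ) (X : Mat) : ‖expHat a θ X‖ = ‖X‖ := by
  rw [expHat_eq, CStarRing.norm_mul_mem_unitary _ (Unitary.star_mem (phase_mem_unitary a θ)),
    CStarRing.norm_mem_unitary_mul _ (phase_mem_unitary a θ)]

theorem expHat_mul (a : Fin 3 → ℝ) (θ : ℝ) (X Y : Mat) :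
    expHat a θ (X * Y) = expHat a θ X * expHat a θ Y := by
  have h := Unitary.star_mul_self_of_mem (phase_mem_unitary a θ)
  simp only [expHat_eq]
  calc phase a θ * (X * Y) * star (phase a θ)
      = phase a θ * X * 1 * Y * star (phase a θ) := by simp only [mul_one, mul_assoc]
    _ = _ := by rw [← h]; simp only [mul_assoc]

theorem star_expHat (a : Fin 3 → ℝ) (θ : ℝ) (X : Mat) :
    star (expHat a θ X) = expHat a θ (star X) := by
  simp only [expHat_eq, star_mul, star_star, mul_assoc]

theorem expHat_one (a : Fin 3 → ℝ) (θ : ℝ) : expHat a θ 1 = 1 := by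
  rw [expHat_eq, mul_one, Unitary.mul_star_self_of_mem (phase_mem_unitary a θ)]

theorem expHat_expHat (a : Fin 3 → ℝ) (θ θ' : ℝ) (X : Mat) :
    expHat a θ (expHat a θ' X) = expHat a (θ + θ') X := by
  ext i j
  rw [expHat_apply, expHat_apply, expHat_apply, ← mul_assoc, ← Complex.exp_add]
  congr 2
  push_cast
  ring

theorem expHat_zero (a : Fin 3 → ℝ) (X : Mat) : expHat a 0 X = X := by
  ext i j
  simp [expHat_apply]

theorem expHat_neg (a : Fin 3 → ℝ) (θ : ℝ) (X : Mat) :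
    expHat a θ (-X) = -expHat a θ X := by
  simp [expHat_eq]

theorem expHat_sub (a : Fin 3 → ℝ) (θ : ℝ) (X Y : Mat) :
    expHat a θ (X - Y) = expHat a θ X - expHat a θ Y := by
  simp [expHat_eq, mul_sub, sub_mul]

theorem expHat_add (a : Fin 3 → ℝ) (θ : ℝ) (X Y : Mat) :
    expHat a θ (X + Y) = expHat a θ X + expHat a θ Y := by
  simp [expHat_eq, mul_add, add_mul]

theorem expHat_neg_exponents (a : Fin 3 → ℝ) (θ : ℝ) (X : Mat) :
    expHat (-a) θ X = expHat a (-θ) X := by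
  ext i j
  rw [expHat_apply, expHat_apply]
  congr 3
  simp only [Pi.neg_apply]
  ring_nf

theorem continuous_phase (a : Fin 3 → ℝ) : Continuous (phase a) := by
  unfold phase
  fun_prop

theorem aestronglyMeasurable_expHat {α : Type*} [MeasurableSpace α] {μ : Measure α}
    (a : Fin 3 → ℝ) {θ : α → ℝ} {X : α → Mat} (hθ : AEStronglyMeasurable θ μ)
    (hX : AEStronglyMeasurable X μ) : AEStronglyMeasurable (fun x => expHat a (θ x) (X x)) μ := by
  simp only [expHat_eq]
  have h := (continuous_phase a).comp_aestronglyMeasurable hθ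
  exact (h.mul hX).mul h.star

theorem continuous_expHat {α : Type*} [TopologicalSpace α]
    (a : Fin 3 → ℝ) {θ : α → ℝ} {X : α → Mat} (hθ : Continuous θ)
    (hX : Continuous X) : Continuous fun x => expHat a (θ x) (X x) := by
  simp only [expHat_eq]
  have h := (continuous_phase a).comp hθ
  exact (h.mul hX).mul h.star

/-! ### Potentials of Sobolev class -/

/-- `P` is a continuous skew-adjoint potential with zero diagonal and entries in `H^{1,2}(ℝ)`,
and `P'` is its weak derivative, in the sense that `P` is a primitive of `P'`. -/
structure IsPotential (P P' : ℝ → Mat) : Prop where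
  rep : ∀ i j, IsSobolevRep (fun x => P x i j) fun x => P' x i j
  skew : ∀ x, star (P x) = -P x
  diag : ∀ x i, P x i i = 0

variable {P P' : ℝ → Mat}

theorem IsPotential.continuous (h : IsPotential P P') : Continuous P :=
  continuous_matrix fun i j => (h.rep i j).continuous

theorem IsPotential.integrable (h : IsPotential P P') : Integrable P :=
  integrable_matrix fun i j => (h.rep i j).integrable

theorem IsPotential.memLp (h : IsPotential P P') : MemLp P 2 volume :=
  memLp_matrix fun i j => (h.rep i j).memLp

theorem IsPotential.reflect (h : IsPotential P P') :
    IsPotential (fun x => -P (-x)) fun x => P' (-x) where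
  rep i j := (h.rep i j).comp_neg
  skew x := by simp [h.skew]
  diag x i := by simp [h.diag]

/-- The coefficient `e^{-izyÂ} P(y)` of the equation satisfied by `e^{-izxÂ} μ(x, z)`. -/
noncomputable def coeff (a : Fin 3 → ℝ) (P : ℝ → Mat) (z y : ℝ) : Mat :=
  expHat a (-(z * y)) (P y)

/-- The matrix `-iy [A, P(y)]`, which arises from `coeff` by differentiation in `z`. -/
noncomputable def momentPotential (a : Fin 3 → ℝ) (P : ℝ → Mat) (y : ℝ) : Mat :=
  Matrix.of fun i j => -(Complex.I * (a i - a j : ℝ)) * (y * P y i j)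

theorem IsPotential.isSkewPotential (h : IsPotential P P') (a : Fin 3 → ℝ) (z : ℝ) :
    IsSkewPotential (coeff a P z) where
  cont := continuous_expHat a (by fun_prop) h.continuous
  skew x := by rw [coeff, star_expHat, h.skew, expHat_neg]
  integrable := h.integrable.mono
    (continuous_expHat a (by fun_prop) h.continuous).aestronglyMeasurable
    (Eventually.of_forall fun y => (norm_expHat _ _ _).le)

theorem IsPotential.integrable_momentPotential (h : IsPotential P P') (a : Fin 3 → ℝ) :
    Integrable (momentPotential a P) :=
  integrable_matrix fun i j => (h.rep i j).integrable_id_mul.const_mul _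

theorem IsPotential.memLp_momentPotential (h : IsPotential P P') (a : Fin 3 → ℝ) :
    MemLp (momentPotential a P) 2 volume :=
  memLp_matrix fun i j => ((h.rep i j).memLp_mul (c := fun x => x) continuous_id fun x =>
    abs_le.2 ⟨by nlinarith [sq_nonneg (x + 1)], by nlinarith [sq_nonneg (x - 1)]⟩).const_mul _

/-- The weight in `H^{1,2}(ℝ)` makes `y P(y)` integrable, so that the coefficients can be
differentiated in `z`. -/
theorem IsPotential.isSkewFamily (h : IsPotential P P') (a : Fin 3 → ℝ) :
    IsSkewFamily (coeff a P) (coeff a (momentPotential a P))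
      fun y => ‖momentPotential a P y‖ where
  skew := h.isSkewPotential a
  hasDerivAt z y := by
    refine hasDerivAt_matrix fun i j => ?_
    simp only [coeff, expHat_apply, momentPotential, Matrix.of_apply]
    have h1 : HasDerivAt (fun z : ℝ => (Complex.I * (-(z * y) * (a i - a j) : ℝ)))
        (-(Complex.I * (a i - a j : ℝ)) * y) z := by
      have h2 : HasDerivAt (fun z : ℝ => (-(z * y) * (a i - a j) : ℝ))
          (-y * (a i - a j)) z := by
        simpa using (((hasDerivAt_id z).mul_const y).neg.mul_const (a i - a j))
      refine (h2.ofReal_comp.const_mul Complex.I).congr_deriv ?_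
      push_cast
      ring
    refine (h1.cexp.mul_const (P y i j)).congr_deriv ?_
    ring
  norm_le z y := (norm_expHat _ _ _).le
  aestronglyMeasurable z := aestronglyMeasurable_expHat a
    (by fun_prop) (h.integrable_momentPotential a).1
  integrable := (h.integrable_momentPotential a).norm

theorem coeff_reflect (a : Fin 3 → ℝ) (P : ℝ → Mat) (z y : ℝ) :
    -coeff a P z (-y) = coeff (-a) (fun y => -P (-y)) z y := by
  rw [coeff, coeff, expHat_neg_exponents, expHat_neg]
  simp

end MatrixPotential

/-! ### Square integrability of the Jost deviation -/

section SquareIntegrability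

open Filter Topology Set
open scoped Matrix.Norms.L2Operator

local notation "Mat" => Matrix (Fin 3) (Fin 3) ℂ

section Lintegral

variable {α : Type*} [MeasurableSpace α] {μ : Measure α}

theorem sq_eLpNorm_two {ε : Type*} [TopologicalSpace ε] [ContinuousENorm ε] (f : α → ε) :
    eLpNorm f 2 μ ^ 2 = ∫⁻ x, ‖f x‖ₑ ^ 2 ∂μ := by
  have := eLpNorm_nnreal_pow_eq_lintegral (f := f) (μ := μ) (p := 2) (by norm_num)
  simpa using this

theorem sq_lintegral_mul_le {f g : α → ENNReal} (hf : AEMeasurable f μ) (hg : AEMeasurable g μ) :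
    (∫⁻ x, f x * g x ∂μ) ^ 2 ≤ (∫⁻ x, f x ^ 2 ∂μ) * ∫⁻ x, g x ^ 2 ∂μ := by
  have h := ENNReal.lintegral_mul_le_Lp_mul_Lq μ Real.HolderConjugate.two_two hf hg
  have e : ∀ x : ENNReal, (x ^ (1 / (2 : ℝ))) ^ 2 = x := fun x => by
    rw [← ENNReal.rpow_natCast, ← ENNReal.rpow_mul]; norm_num
  calc (∫⁻ x, f x * g x ∂μ) ^ 2 ≤
        ((∫⁻ x, f x ^ (2 : ℝ) ∂μ) ^ (1 / (2 : ℝ)) *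
          (∫⁻ x, g x ^ (2 : ℝ) ∂μ) ^ (1 / (2 : ℝ))) ^ 2 := by
          gcongr; exact h
    _ = _ := by rw [mul_pow, e, e]; simp

theorem ennreal_add_sq_le (a b : ENNReal) : (a + b) ^ 2 ≤ 4 * (a ^ 2 + b ^ 2) := by
  rcases le_total a b with h | h
  · calc (a + b) ^ 2 ≤ (b + b) ^ 2 := by gcongr
      _ = 4 * (0 + b ^ 2) := by ring
      _ ≤ _ := by gcongr; exact zero_le
  · calc (a + b) ^ 2 ≤ (a + a) ^ 2 := by gcongr
      _ = 4 * (a ^ 2 + 0) := by ring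
      _ ≤ _ := by gcongr; exact zero_le

end Lintegral

variable {a : Fin 3 → ℝ} {w : ℝ → Mat}

theorem integrable_coeff {μ : Measure ℝ} (a : Fin 3 → ℝ) (hw : Integrable w μ) (z : ℝ) :
    Integrable (coeff a w z) μ :=
  hw.mono (aestronglyMeasurable_expHat a (by fun_prop) hw.1)
    (Eventually.of_forall fun _ => (norm_expHat _ _ _).le)

theorem aestronglyMeasurable_coeff {μ : Measure ℝ} [SFinite μ] (a : Fin 3 → ℝ)
    (hw : AEStronglyMeasurable w μ) :
    AEStronglyMeasurable (fun p : ℝ × ℝ => coeff a w p.1 p.2) ((volume : Measure ℝ).prod μ) :=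
  aestronglyMeasurable_expHat a (by fun_prop) hw.comp_snd

/-- Plancherel's theorem for the oscillatory integral of an off-diagonal matrix function. -/
theorem exists_eLpNorm_integral_coeff_le (ha : Function.Injective a) : ∃ C : NNReal,
    ∀ w : ℝ → Mat, Integrable w → MemLp w 2 volume → (∀ y i, w y i i = 0) →
      eLpNorm (fun z => ∫ y, coeff a w z y) 2 volume ≤ C * eLpNorm w 2 volume := by
  have h : ∀ i j, ∃ C : NNReal, ∀ w : ℝ → Mat, Integrable w → MemLp w 2 volume →
      (∀ y i, w y i i = 0) →
      eLpNorm (fun z => (∫ y, coeff a w z y) i j) 2 volume ≤ C * eLpNorm w 2 volume := by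
    intro i j
    by_cases hij : i = j
    · refine ⟨0, fun w hw _ h0 => ?_⟩
      have e : (fun z => (∫ y, coeff a w z y) i j) = fun _ => 0 := by
        funext z
        rw [integral_entry (integrable_coeff a hw z)]
        simp [coeff, expHat_apply, hij, h0]
      rw [e]
      simp
    · obtain ⟨C, hC⟩ := eLpNorm_oscillatory (sub_ne_zero.2 fun h => hij (ha h) : a i - a j ≠ 0)
      refine ⟨C, fun w hw hw2 _ => ?_⟩
      have e : (fun z => (∫ y, coeff a w z y) i j) = fun z : ℝ =>
          ∫ y, Complex.exp (-(Complex.I * (z * y * (a i - a j) : ℝ))) * w y i j := by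
        funext z
        rw [integral_entry (integrable_coeff a hw z)]
        refine integral_congr_ae (Eventually.of_forall fun y => ?_)
        simp only [coeff, expHat_apply]
        congr 2
        push_cast
        ring
      rw [e]
      refine (hC _ ?_ (memLp_entry hw2 i j)).trans ?_
      · exact (entryCLM i j).integrable_comp hw
      · gcongr
        exact eLpNorm_mono fun y => norm_entry_le _ i j
  choose C hC using h
  refine ⟨∑ i, ∑ j, C i j, fun w hw hw2 h0 => ?_⟩
  have hm : AEStronglyMeasurable (fun z => ∫ y, coeff a w z y) :=
    (aestronglyMeasurable_coeff a hw.1).integral_prod_right'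
  refine (eLpNorm_matrix_le hm).trans ?_
  push_cast
  simp only [Finset.sum_mul]
  exact Finset.sum_le_sum fun i _ => Finset.sum_le_sum fun j _ => hC i j w hw hw2 h0

theorem coeff_indicator (a : Fin 3 → ℝ) (w : ℝ → Mat) (s : Set ℝ) (z : ℝ) :
    coeff a (s.indicator w) z = s.indicator (coeff a w z) := by
  funext t
  by_cases ht : t ∈ s
  · simp [indicator_of_mem ht, coeff]
  · simp [indicator_of_notMem ht, coeff, expHat]

theorem exists_eLpNorm_setIntegral_coeff_le (ha : Function.Injective a) : ∃ C : NNReal,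
    ∀ w : ℝ → Mat, Integrable w → MemLp w 2 volume → (∀ y i, w y i i = 0) →
      ∀ s : Set ℝ, MeasurableSet s →
        eLpNorm (fun z => ∫ y in s, coeff a w z y) 2 volume ≤
          C * eLpNorm (s.indicator w) 2 volume := by
  obtain ⟨C, hC⟩ := exists_eLpNorm_integral_coeff_le ha
  refine ⟨C, fun w hwi hw h0 s hs => ?_⟩
  simp_rw [← integral_indicator hs, ← coeff_indicator]
  refine hC _ (hwi.indicator hs) (hw.indicator hs) fun t i => ?_
  by_cases ht : t ∈ s
  · simp [indicator_of_mem ht, h0]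
  · simp [indicator_of_notMem ht]

variable {P P' : ℝ → Mat} {M : ℝ → ℝ → Mat}

/-- The weight in `H^{1,2}(ℝ)` makes the `L²` norm of the potential over `(y, ∞)` decay like
`(1 + y²)⁻¹`, which is square integrable in `y`. -/
theorem IsPotential.exists_eLpNorm_tail_le (h : IsPotential P P') : ∃ K : ENNReal, K ≠ ⊤ ∧
    ∀ y : ℝ, 0 ≤ y → eLpNorm ((Ioi y).indicator P) 2 volume ≤
      ENNReal.ofReal (1 + y ^ 2)⁻¹ * K := by
  refine ⟨∑ i, ∑ j, eLpNorm (fun x : ℝ => (1 + x ^ 2) • P x i j) 2 volume, ?_, fun y hy => ?_⟩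
  · exact (ENNReal.sum_lt_top.2 fun i _ => ENNReal.sum_lt_top.2 fun j _ =>
      (h.rep i j).memLp_weight.2).ne
  · refine (eLpNorm_matrix_le
      (h.continuous.aestronglyMeasurable.indicator measurableSet_Ioi)).trans ?_
    simp only [Finset.mul_sum]
    refine Finset.sum_le_sum fun i _ => Finset.sum_le_sum fun j _ => ?_
    refine le_trans (le_of_eq ?_) (eLpNorm_tail_le (fun x => P x i j) hy)
    congr 1
    funext x
    by_cases hx : x ∈ Ioi y
    · simp [indicator_of_mem hx]
    · simp [indicator_of_notMem hx]

theorem lintegral_ofReal_inv_one_add_sq_sq_lt_top :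
    ∫⁻ y : ℝ, ENNReal.ofReal (1 + y ^ 2)⁻¹ ^ 2 < ⊤ := by
  refine lt_of_le_of_lt (lintegral_mono fun y => ?_)
    (integrable_inv_one_add_sq.lintegral_lt_top)
  have h1 : ENNReal.ofReal (1 + y ^ 2)⁻¹ ≤ 1 := by
    rw [ENNReal.ofReal_le_one]
    exact inv_le_one_of_one_le₀ (by nlinarith [sq_nonneg y])
  calc ENNReal.ofReal (1 + y ^ 2)⁻¹ ^ 2 ≤ ENNReal.ofReal (1 + y ^ 2)⁻¹ * 1 := by
        rw [sq]; gcongr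
    _ = _ := mul_one _

/-- The tail integral of `coeff` is the Fourier transform of the tail of the potential, whose `L²`
norm decays. -/
theorem IsPotential.lintegral_tail_sq_lt_top (h : IsPotential P P') (ha : Function.Injective a) :
    ∫⁻ z : ℝ, ∫⁻ y in Ioi (0 : ℝ), ‖∫ t in Ioi y, coeff a P z t‖ₑ ^ 2 < ⊤ := by
  obtain ⟨C, hC⟩ := exists_eLpNorm_setIntegral_coeff_le ha
  obtain ⟨K, hK, htail⟩ := h.exists_eLpNorm_tail_le
  have hJ' := lintegral_ofReal_inv_one_add_sq_sq_lt_top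
  have hTc := (h.isSkewFamily a).continuous_tailIntegral
  have h1 : ∀ y, 0 ≤ y → ∫⁻ z, ‖∫ t in Ioi y, coeff a P z t‖ₑ ^ 2 ≤
      (C * K) ^ 2 * ENNReal.ofReal (1 + y ^ 2)⁻¹ ^ 2 := by
    intro y hy
    rw [← sq_eLpNorm_two (fun z => ∫ t in Ioi y, coeff a P z t), ← mul_pow]
    gcongr
    refine (hC _ h.integrable h.memLp h.diag _ measurableSet_Ioi).trans ?_
    rw [mul_assoc, mul_comm K]
    gcongr
    exact htail y hy
  have hTm : Measurable fun p : ℝ × ℝ => ‖∫ t in Ioi p.2, coeff a P p.1 t‖ₑ ^ 2 :=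
    hTc.enorm.measurable.pow_const 2
  rw [lintegral_lintegral_swap hTm.aemeasurable]
  calc ∫⁻ y in Ioi (0 : ℝ), ∫⁻ z, ‖∫ t in Ioi y, coeff a P z t‖ₑ ^ 2
      ≤ ∫⁻ y in Ioi (0 : ℝ), (C * K) ^ 2 * ENNReal.ofReal (1 + y ^ 2)⁻¹ ^ 2 :=
        setLIntegral_mono' measurableSet_Ioi fun y hy => h1 y (le_of_lt hy)
    _ ≤ ∫⁻ y, (C * K) ^ 2 * ENNReal.ofReal (1 + y ^ 2)⁻¹ ^ 2 := setLIntegral_le_lintegral _ _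
    _ = (C * K) ^ 2 * ∫⁻ y : ℝ, ENNReal.ofReal (1 + y ^ 2)⁻¹ ^ 2 :=
        lintegral_const_mul _ (by fun_prop)
    _ < ⊤ := ENNReal.mul_lt_top
        (ENNReal.pow_lt_top (ENNReal.mul_lt_top ENNReal.coe_lt_top hK.lt_top)) hJ'

theorem IsPotential.sq_enorm_jost_sub_one_le (h : IsPotential P P')
    (hM : ∀ z, IsJost (coeff a P z) (M z)) (z y : ℝ) :
    ‖M z y - 1‖ₑ ^ 2 ≤ 4 * (‖∫ t in Ioi y, coeff a P z t‖ₑ ^ 2 +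
      (∫⁻ t in Ioi y, ‖P t‖ₑ ^ 2) * ∫⁻ s in Ioi y, ‖∫ t in Ioi s, coeff a P z t‖ₑ ^ 2) := by
  set T : ℝ → Mat := fun y => ∫ t in Ioi y, coeff a P z t with hT
  have hTz : Continuous T :=
    (h.isSkewFamily a).continuous_tailIntegral.comp (Continuous.prodMk_right z)
  have e1 : ‖M z y - 1‖ₑ ≤ ‖T y‖ₑ + ∫⁻ t in Ioi y, ‖P t‖ₑ * ‖T t‖ₑ := by
    have hb := (hM z).norm_sub_one_le (h.isSkewPotential a z) y
    have hb' : ‖M z y - 1‖ₑ ≤ ‖T y‖ₑ + ‖∫ t in Ioi y, ‖P t‖ * ‖T t‖‖ₑ := by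
      simp only [coeff, norm_expHat] at hb
      rw [← ofReal_norm, ← ofReal_norm, ← ofReal_norm,
        ← ENNReal.ofReal_add (norm_nonneg _) (norm_nonneg _)]
      refine ENNReal.ofReal_le_ofReal (hb.trans ?_)
      exact add_le_add le_rfl (Real.le_norm_self _)
    refine hb'.trans ?_
    gcongr
    refine (enorm_integral_le_lintegral_enorm _).trans (lintegral_mono fun t => ?_)
    rw [enorm_mul, enorm_norm, enorm_norm]
  calc ‖M z y - 1‖ₑ ^ 2 ≤ (‖T y‖ₑ + ∫⁻ t in Ioi y, ‖P t‖ₑ * ‖T t‖ₑ) ^ 2 := by gcongr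
    _ ≤ 4 * (‖T y‖ₑ ^ 2 + (∫⁻ t in Ioi y, ‖P t‖ₑ * ‖T t‖ₑ) ^ 2) := ennreal_add_sq_le _ _
    _ ≤ _ := by
      gcongr
      exact sq_lintegral_mul_le h.continuous.enorm.measurable.aemeasurable
        hTz.enorm.measurable.aemeasurable

/-- Integration over `y > 0`, `z ∈ ℝ` of a bound of the form
`F z y + k y ∫ F z`, with `k` integrable. -/
theorem lintegral_lintegral_lt_top_of_le {G F : ℝ → ℝ → ENNReal} {k : ℝ → ENNReal}
    (hF : Measurable fun p : ℝ × ℝ => F p.1 p.2) (hk : Measurable k)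
    (hk' : ∫⁻ y in Ioi (0 : ℝ), k y < ⊤) (hF' : ∫⁻ z, ∫⁻ y in Ioi (0 : ℝ), F z y < ⊤)
    (h : ∀ z, ∀ y ∈ Ioi (0 : ℝ), G z y ≤ 4 * (F z y + k y * ∫⁻ s in Ioi (0 : ℝ), F z s)) :
    ∫⁻ z, ∫⁻ y in Ioi (0 : ℝ), G z y < ⊤ := by
  have h4 : ∀ z, ∫⁻ y in Ioi (0 : ℝ), G z y ≤
      4 * (1 + ∫⁻ y in Ioi (0 : ℝ), k y) * ∫⁻ s in Ioi (0 : ℝ), F z s := by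
    intro z
    have hFz : Measurable (F z) := hF.comp measurable_prodMk_left
    refine (setLIntegral_mono' measurableSet_Ioi (h z)).trans (le_of_eq ?_)
    have hm : Measurable fun y => F z y + k y * ∫⁻ s in Ioi (0 : ℝ), F z s :=
      hFz.add (hk.mul_const _)
    rw [lintegral_const_mul _ hm, lintegral_add_left hFz,
      lintegral_mul_const _ hk]
    ring
  refine (lintegral_mono h4).trans_lt ?_
  rw [lintegral_const_mul _ hF.lintegral_prod_right']
  exact ENNReal.mul_lt_top (ENNReal.mul_lt_top (by norm_num)
    (ENNReal.add_lt_top.2 ⟨by norm_num, hk'⟩)) hF'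

/-- The deviation `M - 1` of the Jost solution from its limit at `+∞` is square integrable over
`y > 0`, `z ∈ ℝ`. -/
theorem IsPotential.lintegral_jost_sub_one_lt_top (h : IsPotential P P')
    (ha : Function.Injective a) (hM : ∀ z, IsJost (coeff a P z) (M z)) :
    ∫⁻ z : ℝ, ∫⁻ y in Ioi (0 : ℝ), ‖M z y - 1‖ₑ ^ 2 < ⊤ := by
  obtain ⟨K, hK, htail⟩ := h.exists_eLpNorm_tail_le
  have hk : Measurable fun y : ℝ => K ^ 2 * ENNReal.ofReal (1 + y ^ 2)⁻¹ ^ 2 := by fun_prop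
  refine lintegral_lintegral_lt_top_of_le
    (F := fun z y => ‖∫ t in Ioi y, coeff a P z t‖ₑ ^ 2)
    ((h.isSkewFamily a).continuous_tailIntegral.enorm.measurable.pow_const 2) hk ?_
    (h.lintegral_tail_sq_lt_top ha) fun z y hy => ?_
  · refine (setLIntegral_le_lintegral _ _).trans_lt ?_
    rw [lintegral_const_mul _ (by fun_prop)]
    exact ENNReal.mul_lt_top (ENNReal.pow_lt_top hK.lt_top)
      lintegral_ofReal_inv_one_add_sq_sq_lt_top
  · refine (h.sq_enorm_jost_sub_one_le hM z y).trans ?_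
    gcongr
    · rw [← mul_pow, mul_comm K, ← sq_eLpNorm_two P, ← eLpNorm_indicator_eq_eLpNorm_restrict
        measurableSet_Ioi]
      gcongr
      exact htail y (le_of_lt hy)
    · exact (mem_Ioi.1 hy).le

/-- Cauchy–Schwarz in `y` turns the square integrability of `M - 1` into an `L²` bound in `z`. -/
theorem IsPotential.exists_eLpNorm_lintegral_le (h : IsPotential P P')
    (ha : Function.Injective a) (hM : ∀ z, IsJost (coeff a P z) (M z)) :
    ∃ C : NNReal, ∀ w : ℝ → Mat, AEStronglyMeasurable w →
      eLpNorm (fun z => ∫⁻ y in Ioi (0 : ℝ), ‖w y‖ₑ * ‖M z y - 1‖ₑ) 2 volume ≤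
        C * eLpNorm w 2 volume := by
  set N := ∫⁻ z : ℝ, ∫⁻ y in Ioi (0 : ℝ), ‖M z y - 1‖ₑ ^ 2 with hN
  have hN' : N < ⊤ := h.lintegral_jost_sub_one_lt_top ha hM
  have hMc := (h.isSkewFamily a).continuous_jost hM
  have hm : Measurable fun p : ℝ × ℝ => ‖M p.1 p.2 - 1‖ₑ ^ 2 :=
    (hMc.sub continuous_const).enorm.measurable.pow_const 2
  have hroot : (N ^ (1 / (2 : ℝ))) ^ 2 = N := by
    rw [← ENNReal.rpow_natCast, ← ENNReal.rpow_mul]; norm_num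
  refine ⟨(N ^ (1 / (2 : ℝ))).toNNReal, fun w hw => ?_⟩
  rw [ENNReal.coe_toNNReal (ENNReal.rpow_ne_top_of_nonneg (by norm_num) hN'.ne)]
  rw [← ENNReal.pow_le_pow_left_iff (two_ne_zero), sq_eLpNorm_two, mul_pow, hroot, sq_eLpNorm_two]
  calc ∫⁻ z, ‖∫⁻ y in Ioi (0 : ℝ), ‖w y‖ₑ * ‖M z y - 1‖ₑ‖ₑ ^ 2
      ≤ ∫⁻ z, (∫⁻ y, ‖w y‖ₑ ^ 2) * ∫⁻ y in Ioi (0 : ℝ), ‖M z y - 1‖ₑ ^ 2 := by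
        refine lintegral_mono fun z => ?_
        rw [enorm_eq_self]
        refine (sq_lintegral_mul_le hw.enorm.restrict ?_).trans ?_
        · exact (((hMc.comp (Continuous.prodMk_right z)).sub
            continuous_const).enorm.measurable).aemeasurable
        · exact mul_le_mul_left (setLIntegral_le_lintegral _ _) _
    _ = _ := by
        rw [lintegral_const_mul _ hm.lintegral_prod_right', mul_comm]

end SquareIntegrability

/-! ### Oscillatory integrals against Jost solutions -/

section OscillatoryJost

open Filter Topology Set
open scoped Matrix.Norms.L2Operator

local notation "Mat" => Matrix (Fin 3) (Fin 3) ℂ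

variable {a : Fin 3 → ℝ} {P P' : ℝ → Mat} {M : ℝ → ℝ → Mat} {w : ℝ → Mat}

theorem IsPotential.aestronglyMeasurable_jost (h : IsPotential P P')
    (hM : ∀ z, IsJost (coeff a P z) (M z)) {μ : Measure ℝ} [SFinite μ] :
    AEStronglyMeasurable (fun p : ℝ × ℝ => M p.1 p.2) ((volume : Measure ℝ).prod μ) :=
  ((h.isSkewFamily a).continuous_jost hM).aestronglyMeasurable

theorem IsPotential.continuous_scatter (h : IsPotential P P')
    (hM : ∀ z, IsJost (coeff a P z) (M z)) :
    Continuous fun z => scatter (coeff a P z) (M z) :=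
  continuous_iff_continuousAt.2 fun z => ((h.isSkewFamily a).hasDerivAt_scatter hM z).continuousAt

theorem IsPotential.norm_mul_scatter (h : IsPotential P P')
    (hM : ∀ z, IsJost (coeff a P z) (M z)) (z : ℝ) (X : Mat) :
    ‖X * scatter (coeff a P z) (M z)‖ = ‖X‖ :=
  CStarRing.norm_mul_mem_unitary _ ((hM z).scatter_mem_unitary (h.isSkewPotential a z))

theorem IsPotential.integrable_coeff_mul (h : IsPotential P P')
    (hM : ∀ z, IsJost (coeff a P z) (M z)) {μ : Measure ℝ} (hw : Integrable w μ) (z : ℝ) :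
    Integrable (fun y => coeff a w z y * M z y) μ :=
  hw.mono ((integrable_coeff a hw z).1.mul (hM z).continuous.aestronglyMeasurable)
    (Eventually.of_forall fun y => by
      rw [(hM z).norm_mul (h.isSkewPotential a z), coeff, norm_expHat])

/-- The reflected Jost solutions `y ↦ M(z, -y) S(z)*`, which belong to the reflected potential. -/
theorem IsPotential.reflect_jost (h : IsPotential P P')
    (hM : ∀ z, IsJost (coeff a P z) (M z)) (z : ℝ) :
    IsJost (coeff (-a) (fun y => -P (-y)) z)
      fun y => M z (-y) * star (scatter (coeff a P z) (M z)) := by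
  have := (hM z).reflect (h.isSkewPotential a z)
  simp only [coeff_reflect] at this
  exact this

theorem coeff_comp_neg (a : Fin 3 → ℝ) (w : ℝ → Mat) (z y : ℝ) :
    coeff a w z (-y) = coeff (-a) (fun y => w (-y)) z y := by
  rw [coeff, coeff, expHat_neg_exponents]
  simp

theorem memLp_comp_neg (hw : MemLp w 2 volume) : MemLp (fun y => w (-y)) 2 volume :=
  hw.comp_measurePreserving (Measure.measurePreserving_neg volume)

theorem eLpNorm_comp_neg (hw : MemLp w 2 volume) :
    eLpNorm (fun y => w (-y)) 2 volume = eLpNorm w 2 volume :=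
  eLpNorm_comp_measurePreserving hw.1 (Measure.measurePreserving_neg volume)

/-! ### Half-line estimates -/

theorem IsPotential.exists_eLpNorm_halfLine_le (h : IsPotential P P')
    (ha : Function.Injective a) (hM : ∀ z, IsJost (coeff a P z) (M z)) :
    ∃ C : NNReal, ∀ w : ℝ → Mat, MemLp w 2 volume →
      eLpNorm (fun z => ∫ y in Ioi (0 : ℝ), coeff a w z y * (M z y - 1)) 2 volume ≤
        C * eLpNorm w 2 volume := by
  obtain ⟨C, hC⟩ := h.exists_eLpNorm_lintegral_le ha hM
  refine ⟨C, fun w hw => (eLpNorm_mono_enorm fun z => ?_).trans (hC w hw.1)⟩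
  rw [enorm_eq_self]
  refine (enorm_integral_le_lintegral_enorm _).trans (lintegral_mono fun y => ?_)
  rw [← ofReal_norm, ← ofReal_norm, ← ofReal_norm, ← ENNReal.ofReal_mul (norm_nonneg _)]
  refine ENNReal.ofReal_le_ofReal ((norm_mul_le _ _).trans (le_of_eq ?_))
  rw [coeff, norm_expHat]

theorem integral_Iic_eq_mul {f g : ℝ → Mat} {S : Mat} (hg : IntegrableOn g (Ioi 0))
    (h : ∀ y, f (-y) = g y * S) : ∫ y in Iic (0 : ℝ), f y = (∫ y in Ioi (0 : ℝ), g y) * S := by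
  have := integral_comp_neg_Ioi (0 : ℝ) f
  rw [neg_zero] at this
  rw [← this, ← integral_mul_const_of_integrable hg]
  simp only [h]

theorem IsPotential.integrable_coeff_mul_sub_one (h : IsPotential P P')
    (hM : ∀ z, IsJost (coeff a P z) (M z)) {μ : Measure ℝ} (hw : Integrable w μ) (z : ℝ) :
    Integrable (fun y => coeff a w z y * (M z y - 1)) μ := by
  simp only [mul_sub, mul_one]
  exact (h.integrable_coeff_mul hM hw z).sub (integrable_coeff a hw z)

/-- The left half-line version, by reflection. -/
theorem IsPotential.exists_eLpNorm_leftHalfLine_le (h : IsPotential P P')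
    (ha : Function.Injective a) (hM : ∀ z, IsJost (coeff a P z) (M z)) :
    ∃ C : NNReal, ∀ w : ℝ → Mat, Integrable w → MemLp w 2 volume →
      eLpNorm (fun z => ∫ y in Iic (0 : ℝ),
        coeff a w z y * (M z y - scatter (coeff a P z) (M z))) 2 volume ≤
        C * eLpNorm w 2 volume := by
  obtain ⟨C, hC⟩ := h.reflect.exists_eLpNorm_halfLine_le (a := -a) (neg_injective.comp ha)
    (h.reflect_jost hM)
  refine ⟨C, fun w hwi hw => ?_⟩
  rw [← eLpNorm_comp_neg hw]
  refine le_trans (eLpNorm_mono fun z => le_of_eq ?_) (hC _ (memLp_comp_neg hw))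
  have hSS := Unitary.star_mul_self_of_mem ((hM z).scatter_mem_unitary (h.isSkewPotential a z))
  rw [integral_Iic_eq_mul (S := scatter (coeff a P z) (M z))
    (h.reflect.integrable_coeff_mul_sub_one (h.reflect_jost hM) hwi.comp_neg z).integrableOn
    fun y => ?_, h.norm_mul_scatter hM]
  rw [coeff_comp_neg, mul_assoc, sub_mul, mul_assoc, hSS, mul_one, one_mul]

/-- Off the diagonal, integration against the Jost solutions is bounded from `L²` to `L²`, just as
the Fourier transform is: the Jost solutions are replaced by their limits `1` and `S` on the two
half-lines, at the cost of a square integrable error. -/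
theorem IsPotential.exists_eLpNorm_integral_coeff_mul_le (h : IsPotential P P')
    (ha : Function.Injective a) (hM : ∀ z, IsJost (coeff a P z) (M z)) :
    ∃ C : NNReal, ∀ w : ℝ → Mat, Integrable w → MemLp w 2 volume → (∀ y i, w y i i = 0) →
      eLpNorm (fun z => ∫ y, coeff a w z y * M z y) 2 volume ≤ C * eLpNorm w 2 volume := by
  obtain ⟨C₁, h₁⟩ := h.exists_eLpNorm_halfLine_le ha hM
  obtain ⟨C₂, h₂⟩ := h.exists_eLpNorm_leftHalfLine_le ha hM
  obtain ⟨C₃, h₃⟩ := exists_eLpNorm_setIntegral_coeff_le ha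
  refine ⟨C₁ + C₃ + (C₂ + C₃), fun w hwi hw h0 => ?_⟩
  have hind : ∀ s : Set ℝ, MeasurableSet s →
      eLpNorm (fun z => ∫ y in s, coeff a w z y) 2 volume ≤ C₃ * eLpNorm w 2 volume := by
    intro s hs
    refine (h₃ w hwi hw h0 s hs).trans ?_
    gcongr
    exact eLpNorm_indicator_le _
  set S : ℝ → Mat := fun z => scatter (coeff a P z) (M z) with hS
  have hSc : Continuous S := h.continuous_scatter hM
  have e : (fun z => ∫ y, coeff a w z y * M z y) =
      ((fun z => ∫ y in Ioi (0 : ℝ), coeff a w z y * (M z y - 1)) +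
        fun z => ∫ y in Ioi (0 : ℝ), coeff a w z y) +
      ((fun z => ∫ y in Iic (0 : ℝ), coeff a w z y * (M z y - S z)) +
        fun z => (∫ y in Iic (0 : ℝ), coeff a w z y) * S z) := by
    funext z
    have i1 := h.integrable_coeff_mul hM hwi z
    have i2 := integrable_coeff a hwi z
    have i3 : Integrable fun y => coeff a w z y * S z := i2.mul_const _
    simp only [Pi.add_apply, mul_sub, mul_one]
    rw [integral_sub i1.integrableOn i2.integrableOn, integral_sub i1.integrableOn i3.integrableOn,
      integral_mul_const_of_integrable i2.integrableOn,
      ← intervalIntegral.integral_Iic_add_Ioi i1.integrableOn i1.integrableOn (b := 0)]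
    abel
  have mc : ∀ (μ : Measure ℝ) [SFinite μ], AEStronglyMeasurable w μ →
      AEStronglyMeasurable (fun p : ℝ × ℝ => coeff a w p.1 p.2) ((volume : Measure ℝ).prod μ) :=
    fun μ _ hμ => aestronglyMeasurable_coeff a hμ
  have m1 : AEStronglyMeasurable (fun z => ∫ y in Ioi (0 : ℝ), coeff a w z y * (M z y - 1)) :=
    ((mc _ hwi.1.restrict).mul ((h.aestronglyMeasurable_jost hM).sub
      aestronglyMeasurable_const)).integral_prod_right'
  have m2 : AEStronglyMeasurable (fun z => ∫ y in Ioi (0 : ℝ), coeff a w z y) :=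
    (mc _ hwi.1.restrict).integral_prod_right'
  have m3 : AEStronglyMeasurable (fun z => ∫ y in Iic (0 : ℝ), coeff a w z y * (M z y - S z)) :=
    ((mc _ hwi.1.restrict).mul ((h.aestronglyMeasurable_jost hM).sub
      hSc.aestronglyMeasurable.comp_fst)).integral_prod_right'
  have m4 : AEStronglyMeasurable (fun z => (∫ y in Iic (0 : ℝ), coeff a w z y) * S z) :=
    (mc _ hwi.1.restrict).integral_prod_right'.mul hSc.aestronglyMeasurable
  rw [e]
  refine (eLpNorm_add_le (m1.add m2) (m3.add m4) (by norm_num)).trans ?_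
  refine (add_le_add (eLpNorm_add_le m1 m2 (by norm_num))
    (eLpNorm_add_le m3 m4 (by norm_num))).trans ?_
  push_cast
  rw [add_mul, add_mul, add_mul]
  refine add_le_add (add_le_add (h₁ w hw) (hind _ measurableSet_Ioi))
    (add_le_add (h₂ w hwi hw) ?_)
  refine le_trans (eLpNorm_mono fun z => le_of_eq ?_) (hind (Iic 0) measurableSet_Iic)
  exact h.norm_mul_scatter hM z _

/-- On the half-line where the Jost solution tends to `1`, both of its occurrences can be replaced
by `1` at the cost of a square-integrable error. -/
theorem IsPotential.memLp_conjugated_halfLine (h : IsPotential P P')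
    (ha : Function.Injective a) (hM : ∀ z, IsJost (coeff a P z) (M z)) (hwi : Integrable w)
    (hw : MemLp w 2 volume) (h0 : ∀ y i, w y i i = 0) :
    MemLp (fun z => ∫ y in Ioi (0 : ℝ), star (M z y) * coeff a w z y * M z y) 2 volume := by
  obtain ⟨C₁, h₁⟩ := h.exists_eLpNorm_lintegral_le ha hM
  obtain ⟨C₃, h₃⟩ := exists_eLpNorm_setIntegral_coeff_le ha
  have hq := fun z => h.isSkewPotential a z
  have hMm := h.aestronglyMeasurable_jost hM (μ := volume.restrict (Ioi 0))
  have hcm := aestronglyMeasurable_coeff a (hwi.1.restrict (s := Ioi 0))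
  have i0 := fun z => (integrable_coeff a hwi z).integrableOn (s := Ioi 0)
  have i1 : ∀ z, IntegrableOn (fun y => star (M z y) * coeff a w z y * M z y) (Ioi 0) :=
    fun z => ((hM z).integrable_star_mul_mul (hq z) (hq z) (hM z)
      (integrable_coeff a hwi z)).integrableOn
  -- the error of replacing both factors `M` by `1`
  have hR : MemLp (fun z => ∫ y in Ioi (0 : ℝ),
      (star (M z y) * coeff a w z y * M z y - coeff a w z y)) 2 volume := by
    refine ⟨(((hMm.star.mul hcm).mul hMm).sub hcm).integral_prod_right', ?_⟩
    refine lt_of_le_of_lt (eLpNorm_mono_enorm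
      (g := fun z => ∫⁻ y in Ioi (0 : ℝ), ‖(2 : ℝ) • w y‖ₑ * ‖M z y - 1‖ₑ) fun z => ?_)
      ((h₁ (fun y => (2 : ℝ) • w y) (hw.const_smul (2 : ℝ)).1).trans_lt
        (ENNReal.mul_lt_top ENNReal.coe_lt_top (hw.const_smul (2 : ℝ)).2))
    rw [enorm_eq_self]
    refine (enorm_integral_le_lintegral_enorm _).trans (lintegral_mono fun y => ?_)
    rw [← ofReal_norm, ← ofReal_norm, ← ofReal_norm, ← ENNReal.ofReal_mul (norm_nonneg _)]
    refine ENNReal.ofReal_le_ofReal ?_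
    have e : star (M z y) * coeff a w z y * M z y - coeff a w z y =
        star (M z y - 1) * coeff a w z y * M z y + coeff a w z y * (M z y - 1) := by
      rw [star_sub, star_one]
      noncomm_ring
    have n1 : ‖coeff a w z y‖ = ‖w y‖ := norm_expHat _ _ _
    rw [e]
    refine (norm_add_le _ _).trans ?_
    rw [(hM z).norm_mul (hq z)]
    have b1 := norm_mul_le (star (M z y - 1)) (coeff a w z y)
    have b2 := norm_mul_le (coeff a w z y) (M z y - 1)
    rw [norm_star, n1] at b1
    rw [n1] at b2
    rw [norm_smul, Real.norm_ofNat]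
    linarith
  have hF : MemLp (fun z => ∫ y in Ioi (0 : ℝ), coeff a w z y) 2 volume := by
    refine ⟨hcm.integral_prod_right', ?_⟩
    exact (h₃ w hwi hw h0 _ measurableSet_Ioi).trans_lt
      (ENNReal.mul_lt_top ENNReal.coe_lt_top (hw.indicator measurableSet_Ioi).2)
  refine (hR.add hF).ae_eq (Eventually.of_forall fun z => ?_)
  simp only [Pi.add_apply]
  rw [integral_sub (i1 z) (i0 z)]
  abel

/-- Up to sign, and for a suitable weight `w`, this is the derivative of the scattering matrix. -/
theorem IsPotential.memLp_conjugated (h : IsPotential P P')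
    (ha : Function.Injective a) (hM : ∀ z, IsJost (coeff a P z) (M z)) (hwi : Integrable w)
    (hw : MemLp w 2 volume) (h0 : ∀ y i, w y i i = 0) :
    MemLp (fun z => scatter (coeff a P z) (M z) *
      ∫ y, star (M z y) * coeff a w z y * M z y) 2 volume := by
  have hr := h.reflect.memLp_conjugated_halfLine (neg_injective.comp ha) (h.reflect_jost hM)
    hwi.comp_neg (memLp_comp_neg hw) fun y i => h0 (-y) i
  have hl := h.memLp_conjugated_halfLine ha hM hwi hw h0
  have hSc := h.continuous_scatter hM
  have hu := fun z => (hM z).scatter_mem_unitary (h.isSkewPotential a z)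
  have hq := fun z => h.isSkewPotential a z
  -- on the left half-line the outer factor `S` is absorbed by the reflected Jost solution
  have e : ∀ z, scatter (coeff a P z) (M z) * ∫ y, star (M z y) * coeff a w z y * M z y =
      scatter (coeff a P z) (M z) * (∫ y in Ioi (0 : ℝ), star (M z y) * coeff a w z y * M z y) +
      (∫ y in Ioi (0 : ℝ), star (M z (-y) * star (scatter (coeff a P z) (M z))) *
        coeff (-a) (fun y => w (-y)) z y * (M z (-y) * star (scatter (coeff a P z) (M z)))) *
        scatter (coeff a P z) (M z) := by
    intro z
    have i1 : Integrable (fun y => star (M z y) * coeff a w z y * M z y) :=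
      (hM z).integrable_star_mul_mul (hq z) (hq z) (hM z) (integrable_coeff a hwi z)
    have i2 := (h.reflect_jost hM z).integrable_star_mul_mul
      (h.reflect.isSkewPotential (-a) z) (h.reflect.isSkewPotential (-a) z) (h.reflect_jost hM z)
      (integrable_coeff (-a) hwi.comp_neg z)
    rw [← intervalIntegral.integral_Iic_add_Ioi i1.integrableOn i1.integrableOn (b := 0),
      ← integral_Iic_eq_mul (f := fun y => scatter (coeff a P z) (M z) *
        (star (M z y) * coeff a w z y * M z y)) i2.integrableOn, mul_add, add_comm,
      integral_const_mul_of_integrable i1.integrableOn]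
    intro y
    rw [star_mul, star_star, coeff_comp_neg]
    have := Unitary.star_mul_self_of_mem (hu z)
    simp only [mul_assoc]
    rw [this, mul_one]
  have m1 : MemLp (fun z => scatter (coeff a P z) (M z) *
      ∫ y in Ioi (0 : ℝ), star (M z y) * coeff a w z y * M z y) 2 volume :=
    hl.mono (hSc.aestronglyMeasurable.mul hl.1) (Eventually.of_forall fun z =>
      (CStarRing.norm_mem_unitary_mul _ (hu z)).le)
  have m2 := hr.mono (hr.1.mul hSc.aestronglyMeasurable) (Eventually.of_forall fun z =>
      (h.norm_mul_scatter hM z _).le)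
  exact (m1.add m2).ae_eq (Eventually.of_forall fun z => (e z).symm)

end OscillatoryJost

/-! ### The scattering matrix, its derivative and integration by parts -/

section Decay

open Filter Topology Set
open scoped Matrix.Norms.L2Operator

local notation "Mat" => Matrix (Fin 3) (Fin 3) ℂ

variable {a : Fin 3 → ℝ} {P P' : ℝ → Mat} {M : ℝ → ℝ → Mat} {w : ℝ → Mat}

theorem IsPotential.memLp_scatter_sub_one (h : IsPotential P P') (ha : Function.Injective a)
    (hM : ∀ z, IsJost (coeff a P z) (M z)) :
    MemLp (fun z => scatter (coeff a P z) (M z) - 1) 2 volume := by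
  obtain ⟨C, hC⟩ := h.exists_eLpNorm_integral_coeff_mul_le ha hM
  have e : (fun z => scatter (coeff a P z) (M z) - 1) =
      -fun z => ∫ y, coeff a P z y * M z y := by
    funext z
    simp [scatter]
  refine ⟨((h.continuous_scatter hM).sub continuous_const).aestronglyMeasurable, ?_⟩
  rw [e, eLpNorm_neg]
  exact (hC P h.integrable h.memLp h.diag).trans_lt
    (ENNReal.mul_lt_top ENNReal.coe_lt_top h.memLp.2)

theorem IsPotential.exists_hasDerivAt_scatter (h : IsPotential P P')
    (ha : Function.Injective a) (hM : ∀ z, IsJost (coeff a P z) (M z)) :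
    ∃ S' : ℝ → Mat, MemLp S' 2 volume ∧
      ∀ z, HasDerivAt (fun z => scatter (coeff a P z) (M z)) (S' z) z :=
  ⟨_, (h.memLp_conjugated ha hM (h.integrable_momentPotential a) (h.memLp_momentPotential a)
    fun y i => by simp [momentPotential]).neg, (h.isSkewFamily a).hasDerivAt_scatter hM⟩

/-- The off-diagonal solution `B` of `-i [A, B] = X`, used to integrate `e^{-izyÂ} X` by parts. On
the diagonal, division by zero gives `0`. -/
noncomputable def commutatorInv (a : Fin 3 → ℝ) (X : Mat) : Mat :=
  Matrix.of fun i j => Complex.I / (a i - a j : ℝ) * X i j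

theorem IsPotential.rep_commutatorInv (h : IsPotential P P') (a : Fin 3 → ℝ) (i j : Fin 3) :
    IsSobolevRep (fun y => commutatorInv a (P y) i j) fun y => commutatorInv a (P' y) i j :=
  (h.rep i j).const_mul _

theorem IsPotential.continuous_commutatorInv (h : IsPotential P P') (a : Fin 3 → ℝ) :
    Continuous fun y => commutatorInv a (P y) :=
  continuous_matrix fun i j => (h.rep_commutatorInv a i j).continuous

/-- The zero diagonal makes up for the division by zero in `commutatorInv`. -/
theorem commutatorInv_mul (ha : Function.Injective a) {X : Mat} (hX : ∀ i, X i i = 0)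
    (i j : Fin 3) : commutatorInv a X i j * -(Complex.I * (a i - a j : ℝ)) = X i j := by
  by_cases hij : i = j
  · subst hij
    simp [hX]
  · have h1 : ((a i - a j : ℝ) : ℂ) ≠ 0 :=
      Complex.ofReal_ne_zero.2 (sub_ne_zero.2 fun h => hij (ha h))
    rw [commutatorInv, Matrix.of_apply]
    field_simp
    rw [Complex.I_sq]
    ring

theorem intervalIntegral_entry {f : ℝ → Mat} {s t : ℝ} (hf : IntervalIntegrable f volume s t)
    (i j : Fin 3) : (∫ y in s..t, f y) i j = ∫ y in s..t, f y i j :=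
  ((entryCLM i j).intervalIntegral_comp_comm hf).symm

theorem intervalIntegrable_entry {f : ℝ → Mat} {s t : ℝ} (hf : IntervalIntegrable f volume s t)
    (i j : Fin 3) : IntervalIntegrable (fun y => f y i j) volume s t :=
  ⟨(entryCLM i j).integrable_comp hf.1, (entryCLM i j).integrable_comp hf.2⟩

theorem intervalIntegrable_coeff_mul (h : IsPotential P P')
    (hM : ∀ z, IsJost (coeff a P z) (M z)) (hw : LocallyIntegrable w) (z s t : ℝ) :
    IntervalIntegrable (fun y => coeff a w z y * M z y) volume s t := by
  have hI := fun s t => hw.integrableOn_isCompact (isCompact_Icc (a := s) (b := t))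
  exact ⟨h.integrable_coeff_mul hM ((hI s t).mono_set Ioc_subset_Icc_self) z,
    h.integrable_coeff_mul hM ((hI t s).mono_set Ioc_subset_Icc_self) z⟩

theorem IsPotential.memLp_commutatorInv_deriv (h : IsPotential P P')
    (a : Fin 3 → ℝ) : MemLp (fun y => commutatorInv a (P' y)) 2 volume :=
  memLp_matrix fun i j => (h.rep_commutatorInv a i j).memLp_deriv

theorem IsPotential.integral_by_parts_entry (h : IsPotential P P') (ha : Function.Injective a)
    (hM : ∀ z, IsJost (coeff a P z) (M z)) (z : ℝ) {s t : ℝ} (hst : s ≤ t) (i j k : Fin 3) :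
    ∫ y in s..t, (coeff a (fun y => commutatorInv a (P' y)) z y i k * M z y k j +
      (z * (coeff a P z y i k * M z y k j) +
        coeff a (fun y => commutatorInv a (P y)) z y i k * (coeff a P z y * M z y) k j)) =
      coeff a (fun y => commutatorInv a (P y)) z t i k * M z t k j -
        coeff a (fun y => commutatorInv a (P y)) z s i k * M z s k j := by
  set e : ℝ → ℂ := fun y => Complex.exp (Complex.I * (-(z * y) * (a i - a k) : ℝ)) with he
  have he' : ∀ y, HasDerivAt e (-(Complex.I * (a i - a k : ℝ)) * z * e y) y := by
    intro y
    have h2 : HasDerivAt (fun y : ℝ => (-(z * y) * (a i - a k) : ℝ)) (-z * (a i - a k)) y := by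
      simpa using (((hasDerivAt_id y).const_mul z).neg.mul_const (a i - a k))
    refine ((h2.ofReal_comp.const_mul Complex.I).cexp).congr_deriv ?_
    simp only [he]
    push_cast
    ring
  have hec : Continuous e := continuous_iff_continuousAt.2 fun y => (he' y).continuousAt
  have hMkj : ∀ y, HasDerivAt (fun y => M z y k j) ((coeff a P z y * M z y) k j) y := fun y =>
    ((entryCLM k j).restrictScalars ℝ).hasFDerivAt.comp_hasDerivAt y ((hM z).hasDerivAt y)
  have hMc : Continuous fun y => M z y k j := (entryCLM k j).continuous.comp (hM z).continuous
  have hQM : Continuous fun y => (coeff a P z y * M z y) k j :=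
    (entryCLM k j).continuous.comp ((h.isSkewPotential a z).cont.mul (hM z).continuous)
  have key := integral_deriv_mul_add_mul_deriv (h := fun y => e y * M z y k j)
    (h.rep_commutatorInv a i k).locallyIntegrable_deriv (h.rep_commutatorInv a i k).primitive
    (fun y => (he' y).mul (hMkj y))
    (((continuous_const.mul hec).mul hMc).add (hec.mul hQM)) hst
  have hE : ∀ (X : ℝ → Mat) (y : ℝ), coeff a X z y i k = e y * X y i k :=
    fun X y => expHat_apply _ _ _ _ _
  calc _ = ∫ y in s..t, (commutatorInv a (P' y) i k * (e y * M z y k j) +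
        commutatorInv a (P y) i k * (-(Complex.I * (a i - a k : ℝ)) * z * e y * M z y k j +
          e y * (coeff a P z y * M z y) k j)) := by
        congr 1
        funext y
        rw [hE, hE, hE, ← commutatorInv_mul ha (h.diag y) i k]
        ring
    _ = _ := key
    _ = _ := by
        rw [hE, hE]
        ring

/-- Integration by parts in the Volterra equation. -/
theorem IsPotential.integral_by_parts (h : IsPotential P P') (ha : Function.Injective a)
    (hM : ∀ z, IsJost (coeff a P z) (M z)) (z : ℝ) {s t : ℝ} (hst : s ≤ t) :
    (∫ y in s..t, coeff a (fun y => commutatorInv a (P' y)) z y * M z y) +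
      (z : ℂ) • (∫ y in s..t, coeff a P z y * M z y) +
      (∫ y in s..t, coeff a (fun y => commutatorInv a (P y) * P y) z y * M z y) =
      coeff a (fun y => commutatorInv a (P y)) z t * M z t -
        coeff a (fun y => commutatorInv a (P y)) z s * M z s := by
  have l1 := (h.memLp_commutatorInv_deriv a).locallyIntegrable (by norm_num)
  have l2 := h.continuous.locallyIntegrable (μ := volume)
  have hB := h.continuous_commutatorInv a
  have l3 : LocallyIntegrable (fun y => commutatorInv a (P y) * P y) :=
    (hB.mul h.continuous).locallyIntegrable (μ := volume)
  have i1 := intervalIntegrable_coeff_mul h hM l1 z s t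
  have i2 : IntervalIntegrable (fun y => (z : ℂ) • (coeff a P z y * M z y)) volume s t :=
    (intervalIntegrable_coeff_mul h hM l2 z s t).smul (z : ℂ)
  have i3 := intervalIntegrable_coeff_mul h hM l3 z s t
  have i12 : IntervalIntegrable (fun y => coeff a (fun y => commutatorInv a (P' y)) z y * M z y +
      (z : ℂ) • (coeff a P z y * M z y)) volume s t := i1.add i2
  rw [← intervalIntegral.integral_smul, ← intervalIntegral.integral_add i1 i2,
    ← intervalIntegral.integral_add i12 i3]
  ext i j
  rw [intervalIntegral_entry (i12.add i3), Matrix.sub_apply,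
    Matrix.mul_apply, Matrix.mul_apply, ← Finset.sum_sub_distrib]
  simp_rw [← h.integral_by_parts_entry ha hM z hst i j]
  have c1 : ∀ k, Continuous fun y => M z y k j := fun k =>
    (entryCLM k j).continuous.comp (hM z).continuous
  have c2 : ∀ k, Continuous fun y => coeff a P z y i k := fun k =>
    (entryCLM i k).continuous.comp (h.isSkewPotential a z).cont
  have c3 : ∀ k, Continuous fun y => coeff a (fun y => commutatorInv a (P y)) z y i k := fun k =>
    (entryCLM i k).continuous.comp (continuous_expHat a (by fun_prop) hB)
  have c4 : ∀ k, Continuous fun y => (coeff a P z y * M z y) k j := fun k =>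
    (entryCLM k j).continuous.comp ((h.isSkewPotential a z).cont.mul (hM z).continuous)
  have i4 : ∀ k, IntervalIntegrable (fun y => coeff a (fun y => commutatorInv a (P' y)) z y i k)
      volume s t := fun k => by
    have hI := fun s t => l1.integrableOn_isCompact (isCompact_Icc (a := s) (b := t))
    exact intervalIntegrable_entry ⟨integrable_coeff a ((hI s t).mono_set Ioc_subset_Icc_self) z,
      integrable_coeff a ((hI t s).mono_set Ioc_subset_Icc_self) z⟩ i k
  rw [← intervalIntegral.integral_finsetSum]
  · congr 1
    funext y
    have e1 : coeff a (fun y => commutatorInv a (P y) * P y) z y * M z y =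
        coeff a (fun y => commutatorInv a (P y)) z y * (coeff a P z y * M z y) := by
      rw [← mul_assoc]
      congr 1
      exact expHat_mul _ _ _ _
    rw [e1, Matrix.add_apply, Matrix.add_apply, Matrix.smul_apply,
      Matrix.mul_apply, Matrix.mul_apply, Matrix.mul_apply (M := coeff a (fun y => _) z y),
      smul_eq_mul, Finset.mul_sum, ← Finset.sum_add_distrib, ← Finset.sum_add_distrib]
    exact Finset.sum_congr rfl fun k _ => by ring
  · intro k _
    exact ((i4 k).mul_continuousOn (c1 k).continuousOn).add
      (((continuous_const.mul ((c2 k).mul (c1 k))).add ((c3 k).mul (c4 k))).intervalIntegrable _ _)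

end Decay

/-! ### Decay of the off-diagonal scattering data -/

section OffDiagonalDecay

open Filter Topology Set
open scoped Matrix.Norms.L2Operator

local notation "Mat" => Matrix (Fin 3) (Fin 3) ℂ

variable {a : Fin 3 → ℝ} {P P' : ℝ → Mat} {M : ℝ → ℝ → Mat} {w : ℝ → Mat}

theorem norm_le_const_of_entries {f : ℝ → Mat} (h : ∀ i j, ∃ C, ∀ x, ‖f x i j‖ ≤ C) :
    ∃ C, ∀ x, ‖f x‖ ≤ C := by
  choose C hC using h
  exact ⟨∑ i, ∑ j, C i j, fun x => (norm_le_sum_entry _).trans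
    (Finset.sum_le_sum fun i _ => Finset.sum_le_sum fun j _ => hC i j x)⟩

theorem norm_diagonal_diag_le (X : Mat) : ‖(Matrix.diagonal fun i => X i i : Mat)‖ ≤ ‖X‖ := by
  rw [Matrix.l2_opNorm_diagonal]
  exact (pi_norm_le_iff_of_nonneg (norm_nonneg _)).2 fun i => norm_entry_le X i i

theorem IsPotential.norm_commutatorInv_mul_le (h : IsPotential P P') (a : Fin 3 → ℝ) :
    ∃ C, ∀ y, ‖commutatorInv a (P y) * P y‖ ≤ C * ‖P y‖ := by
  obtain ⟨C, hC⟩ := norm_le_const_of_entries (f := fun y => commutatorInv a (P y)) fun i j =>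
    (h.rep_commutatorInv a i j).bounded
  exact ⟨C, fun y => (norm_mul_le _ _).trans (mul_le_mul_of_nonneg_right (hC y) (norm_nonneg _))⟩

theorem continuous_diagonal_diag {f : ℝ → Mat} (hf : Continuous f) :
    Continuous fun y => (Matrix.diagonal fun i => f y i i : Mat) :=
  (continuous_pi fun i => (entryCLM i i).continuous.comp hf).matrix_diagonal

theorem tendsto_intervalIntegral_nat {F : Type*} [NormedAddCommGroup F] [NormedSpace ℝ F]
    {f : ℝ → F} (hf : Integrable f) :
    Tendsto (fun n : ℕ => ∫ y in (-(n : ℝ))..n, f y) atTop (𝓝 (∫ y, f y)) :=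
  intervalIntegral_tendsto_integral hf
    (tendsto_neg_atTop_atBot.comp tendsto_natCast_atTop_atTop) tendsto_natCast_atTop_atTop

theorem coeff_diagonal (a : Fin 3 → ℝ) (d : ℝ → Fin 3 → ℂ) (z : ℝ) :
    coeff a (fun y => Matrix.diagonal (d y)) z = fun y => Matrix.diagonal (d y) := by
  funext y
  ext k l
  simp only [coeff, expHat_apply]
  by_cases hkl : k = l
  · simp [hkl]
  · simp [Matrix.diagonal_apply_ne _ hkl]

/-- A diagonal weight contributes, off the diagonal, square integrable terms only: the constant
limits `1` and `S` of the Jost solution enter through off-diagonal entries. -/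
theorem IsPotential.memLp_integral_diagonal_mul (h : IsPotential P P') (ha : Function.Injective a)
    (hM : ∀ z, IsJost (coeff a P z) (M z)) {d : ℝ → Fin 3 → ℂ}
    (hdi : Integrable fun y => (Matrix.diagonal (d y) : Mat))
    (hd : MemLp (fun y => (Matrix.diagonal (d y) : Mat)) 2 volume) {i j : Fin 3} (hij : i ≠ j) :
    MemLp (fun z => (∫ y, (Matrix.diagonal (d y) : Mat) * M z y) i j) 2 volume := by
  obtain ⟨C₁, h₁⟩ := h.exists_eLpNorm_halfLine_le ha hM
  obtain ⟨C₂, h₂⟩ := h.exists_eLpNorm_leftHalfLine_le ha hM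
  set D : ℝ → Mat := fun y => Matrix.diagonal (d y) with hD
  have hcD : ∀ z, coeff a D z = D := fun z => coeff_diagonal a d z
  set S : ℝ → Mat := fun z => scatter (coeff a P z) (M z) with hS
  have hSc : Continuous S := h.continuous_scatter hM
  have m1 : MemLp (fun z => ∫ y in Ioi (0 : ℝ), D y * (M z y - 1)) 2 volume := by
    refine ⟨(hdi.1.restrict.comp_snd.mul ((h.aestronglyMeasurable_jost hM).sub
      aestronglyMeasurable_const)).integral_prod_right', ?_⟩
    have := (h₁ D hd).trans_lt (ENNReal.mul_lt_top ENNReal.coe_lt_top hd.2)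
    simpa only [hcD] using this
  have m2 : MemLp (fun z => ∫ y in Iic (0 : ℝ), D y * (M z y - S z)) 2 volume := by
    refine ⟨(hdi.1.restrict.comp_snd.mul ((h.aestronglyMeasurable_jost hM).sub
      hSc.aestronglyMeasurable.comp_fst)).integral_prod_right', ?_⟩
    have := (h₂ D hdi hd).trans_lt (ENNReal.mul_lt_top ENNReal.coe_lt_top hd.2)
    simpa only [hcD] using this
  have m3 : MemLp (fun z => (∫ y in Iic (0 : ℝ), D y) i i * S z i j) 2 volume := by
    refine MemLp.const_mul ?_ _
    refine (memLp_entry (h.memLp_scatter_sub_one ha hM) i j).ae_eq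
      (Eventually.of_forall fun z => ?_)
    simp [Matrix.sub_apply, Matrix.one_apply_ne hij, hS]
  refine (((memLp_entry m1 i j).add (memLp_entry m2 i j)).add m3).ae_eq
    (Eventually.of_forall fun z => ?_)
  have i1 : Integrable fun y => D y * M z y := by
    have := h.integrable_coeff_mul hM hdi z
    simp only [hcD] at this
    exact this
  have i3 : Integrable fun y => D y * S z := hdi.mul_const _
  have hoff : ∀ (s : Set ℝ) (k l : Fin 3), k ≠ l → (∫ y in s, D y) k l = 0 := by
    intro s k l hkl
    rw [integral_entry hdi.integrableOn]
    simp [hD, Matrix.diagonal_apply_ne _ hkl]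
  have e : ∫ y, D y * M z y = (∫ y in Ioi (0 : ℝ), D y * (M z y - 1)) +
      (∫ y in Iic (0 : ℝ), D y * (M z y - S z)) + (∫ y in Ioi (0 : ℝ), D y) +
      (∫ y in Iic (0 : ℝ), D y) * S z := by
    simp only [mul_sub, mul_one]
    rw [integral_sub i1.integrableOn hdi.integrableOn, integral_sub i1.integrableOn i3.integrableOn,
      integral_mul_const_of_integrable hdi.integrableOn,
      ← intervalIntegral.integral_Iic_add_Ioi i1.integrableOn i1.integrableOn (b := 0)]
    abel
  simp only [Pi.add_apply]
  rw [e, Matrix.add_apply, Matrix.add_apply, Matrix.add_apply, hoff _ i j hij, Matrix.mul_apply,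
    Finset.sum_eq_single i (fun k _ hk => by rw [hoff _ i k hk.symm, zero_mul])
      (fun hi => absurd (Finset.mem_univ i) hi), add_zero]

/-- The off-diagonal entries of the scattering matrix decay like `1 / z` in the `L²` sense. The
boundary terms of the integration by parts vanish at `±∞`, and Fatou's lemma replaces the integrals
against the merely square-integrable derivative of the potential. -/
theorem IsPotential.memLp_id_mul_scatter (h : IsPotential P P') (ha : Function.Injective a)
    (hM : ∀ z, IsJost (coeff a P z) (M z)) {i j : Fin 3} (hij : i ≠ j) :
    MemLp (fun z : ℝ => (z : ℂ) * scatter (coeff a P z) (M z) i j) 2 volume := by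
  obtain ⟨C, hC⟩ := h.exists_eLpNorm_integral_coeff_mul_le ha hM
  obtain ⟨K, hK⟩ := h.norm_commutatorInv_mul_le a
  set S : ℝ → Mat := fun z => scatter (coeff a P z) (M z) with hS
  have hSc : Continuous S := h.continuous_scatter hM
  set B : ℝ → Mat := fun y => commutatorInv a (P y) with hB
  set B' : ℝ → Mat := fun y => commutatorInv a (P' y) with hB'
  have hBc : Continuous B := h.continuous_commutatorInv a
  have hBPc : Continuous fun y => B y * P y := hBc.mul h.continuous
  -- the diagonal and off-diagonal parts of `B P`
  set D : ℝ → Mat := fun y => Matrix.diagonal fun i => (B y * P y) i i with hD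
  set V : ℝ → Mat := fun y => B y * P y - D y with hV
  have hDc : Continuous D := continuous_diagonal_diag hBPc
  have hVc : Continuous V := hBPc.sub hDc
  have hDn : ∀ y, ‖D y‖ ≤ K * ‖P y‖ := fun y => (norm_diagonal_diag_le _).trans (hK y)
  have hVn : ∀ y, ‖V y‖ ≤ (K + K) * ‖P y‖ := fun y =>
    (norm_sub_le _ _).trans (by rw [add_mul]; exact add_le_add (hK y) (hDn y))
  have hDi : Integrable D := (h.integrable.norm.const_mul K).mono' hDc.aestronglyMeasurable
    (Eventually.of_forall hDn)
  have hD2 : MemLp D 2 volume := h.memLp.of_le_mul hDc.aestronglyMeasurable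
    (Eventually.of_forall hDn)
  have hV2 : MemLp V 2 volume := h.memLp.of_le_mul hVc.aestronglyMeasurable
    (Eventually.of_forall hVn)
  have hW2 : MemLp (fun y => B' y + V y) 2 volume := (h.memLp_commutatorInv_deriv a).add hV2
  have hW0 : ∀ y i, (B' y + V y) i i = 0 := by
    intro y i
    simp [hB', hV, hD, commutatorInv]
  have hB'l : LocallyIntegrable B' :=
    (h.memLp_commutatorInv_deriv a).locallyIntegrable (by norm_num)
  have hZ := h.memLp_integral_diagonal_mul ha hM hDi hD2 hij
  -- truncations, for which Plancherel's theorem gives a uniform bound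
  set Y : ℕ → ℝ → Mat := fun n z =>
    ∫ y in (-(n : ℝ))..n, coeff a (fun y => B' y + V y) z y * M z y with hY
  have hneg : ∀ n : ℕ, -(n : ℝ) ≤ n := fun n => by
    have : (0 : ℝ) ≤ n := Nat.cast_nonneg n
    linarith
  have hYe : ∀ n, Y n = fun z => ∫ y, coeff a
      ((Ioc (-(n : ℝ)) n).indicator fun y => B' y + V y) z y * M z y := by
    intro n
    funext z
    rw [hY]
    dsimp only
    rw [intervalIntegral.integral_of_le (hneg n), ← integral_indicator measurableSet_Ioc]
    congr 1
    funext y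
    rw [coeff_indicator]
    by_cases hy : y ∈ Ioc (-(n : ℝ)) n
    · simp [indicator_of_mem hy]
    · simp [indicator_of_notMem hy]
  have hWi : ∀ n : ℕ, Integrable ((Ioc (-(n : ℝ)) n).indicator fun y => B' y + V y) := fun n =>
    (integrable_indicator_iff measurableSet_Ioc).2
      ((hW2.restrict (Ioc (-(n : ℝ)) n)).integrable (by norm_num))
  have hYm : ∀ n, AEStronglyMeasurable (Y n) := by
    intro n
    rw [hYe]
    exact ((aestronglyMeasurable_coeff a (hWi n).1).mul
      (h.aestronglyMeasurable_jost hM)).integral_prod_right'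
  have hYb : ∀ n, eLpNorm (Y n) 2 volume ≤ C * eLpNorm (fun y => B' y + V y) 2 volume := by
    intro n
    rw [hYe]
    refine (hC _ (hWi n) (hW2.indicator measurableSet_Ioc) fun y i => ?_).trans ?_
    · by_cases hy : y ∈ Ioc (-(n : ℝ)) n
      · simp only [indicator_of_mem hy, hW0]
      · simp [indicator_of_notMem hy]
    · gcongr
      exact eLpNorm_indicator_le _
  set Lm : ℝ → ℂ := fun z => (z : ℂ) * S z i j - (∫ y, D y * M z y) i j with hLm
  have hlim : ∀ z, Tendsto (fun n => Y n z i j) atTop (𝓝 (Lm z)) := by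
    intro z
    have hcD : coeff a D z = D := coeff_diagonal a _ z
    have e : ∀ n : ℕ, Y n z = coeff a B z n * M z n - coeff a B z (-n) * M z (-n) -
        (z : ℂ) • (∫ y in (-(n : ℝ))..n, coeff a P z y * M z y) -
        ∫ y in (-(n : ℝ))..n, D y * M z y := by
      intro n
      rw [← h.integral_by_parts ha hM z (hneg n)]
      have i1 := intervalIntegrable_coeff_mul h hM hB'l z (-(n : ℝ)) n
      have i2 := intervalIntegrable_coeff_mul h hM hBPc.locallyIntegrable z (-(n : ℝ)) n
      have i3 : IntervalIntegrable (fun y => D y * M z y) volume (-(n : ℝ)) n :=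
        (hDc.mul (hM z).continuous).intervalIntegrable _ _
      have e1 : ∀ y, coeff a (fun y => B' y + V y) z y * M z y =
          coeff a B' z y * M z y + (coeff a (fun y => B y * P y) z y * M z y - D y * M z y) := by
        intro y
        have : coeff a (fun y => B' y + V y) z y =
            coeff a B' z y + (coeff a (fun y => B y * P y) z y - coeff a D z y) := by
          rw [coeff, expHat_add, hV, expHat_sub]
          rfl
        rw [this, hcD]
        noncomm_ring
      simp only [hY, e1]
      rw [intervalIntegral.integral_add i1 (i2.sub i3), intervalIntegral.integral_sub i2 i3]
      abel
    have t0 : Tendsto B atTop (𝓝 0) ∧ Tendsto B atBot (𝓝 0) :=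
      ⟨tendsto_pi_nhds.2 fun k => tendsto_pi_nhds.2 fun l =>
          (h.rep_commutatorInv a k l).tendsto_zero.1,
        tendsto_pi_nhds.2 fun k => tendsto_pi_nhds.2 fun l =>
          (h.rep_commutatorInv a k l).tendsto_zero.2⟩
    have hnorm : ∀ y, ‖coeff a B z y * M z y‖ = ‖B y‖ := fun y => by
      rw [(hM z).norm_mul (h.isSkewPotential a z), coeff, norm_expHat]
    have t1 : Tendsto (fun n : ℕ => coeff a B z n * M z n) atTop (𝓝 0) := by
      rw [tendsto_zero_iff_norm_tendsto_zero]
      simp only [hnorm]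
      exact (tendsto_zero_iff_norm_tendsto_zero.1 t0.1).comp tendsto_natCast_atTop_atTop
    have t2 : Tendsto (fun n : ℕ => coeff a B z (-n) * M z (-n)) atTop (𝓝 0) := by
      rw [tendsto_zero_iff_norm_tendsto_zero]
      simp only [hnorm]
      exact (tendsto_zero_iff_norm_tendsto_zero.1 t0.2).comp
        (tendsto_neg_atTop_atBot.comp tendsto_natCast_atTop_atTop)
    have t3 := tendsto_intervalIntegral_nat (h.integrable_coeff_mul hM h.integrable z)
    have t4 := tendsto_intervalIntegral_nat (h.integrable_coeff_mul hM hDi z)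
    simp only [hcD] at t4
    have t5 := ((t1.sub t2).sub (t3.const_smul (z : ℂ))).sub t4
    simp_rw [← e] at t5
    have t6 := ((entryCLM i j).continuous.tendsto _).comp t5
    have e2 : entryCLM i j ((0 - 0 - (z : ℂ) • ∫ y, coeff a P z y * M z y) - ∫ y, D y * M z y) =
        Lm z := by
      rw [entryCLM_apply, hLm, hS]
      simp only [scatter, Matrix.sub_apply, Matrix.smul_apply, Matrix.one_apply_ne hij,
        Matrix.zero_apply, smul_eq_mul]
      ring
    rw [← e2]
    exact t6
  have hL : MemLp Lm 2 volume := by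
    refine ⟨aestronglyMeasurable_of_tendsto_ae atTop
      (fun n => aestronglyMeasurable_entry (hYm n) i j) (Eventually.of_forall hlim), ?_⟩
    refine lt_of_le_of_lt ((Lp.eLpNorm_lim_le_liminf_eLpNorm
      (fun n => aestronglyMeasurable_entry (hYm n) i j) Lm (Eventually.of_forall hlim)).trans
        (liminf_le_of_frequently_le' (Frequently.of_forall fun n =>
          (eLpNorm_mono fun z => norm_entry_le _ i j).trans (hYb n))))
      (ENNReal.mul_lt_top ENNReal.coe_lt_top hW2.2)
  refine (hL.add hZ).ae_eq (Eventually.of_forall fun z => ?_)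
  exact sub_add_cancel _ _

end OffDiagonalDecay

/-! ### Quotients in the weighted Sobolev space -/

section Reflection

open Filter Topology Set

/-- The function `|f|²` and its derivative are integrable, so `|f|²` tends to zero. -/
theorem tendsto_zero_of_memLp_two_of_hasDerivAt {f f' : ℝ → ℂ} (hf : MemLp f 2 volume)
    (hf' : MemLp f' 2 volume) (h : ∀ x, HasDerivAt f (f' x) x) :
    Tendsto f (cocompact ℝ) (𝓝 0) := by
  have hd : ∀ x, HasDerivAt (fun x => f x * star (f x)) (f' x * star (f x) + f x * star (f' x)) x :=
    fun x => (h x).mul (h x).star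
  have i1 : Integrable fun x => f x * star (f x) := hf.integrable_mul hf.star
  have i2 : Integrable fun x => f' x * star (f x) + f x * star (f' x) :=
    (hf'.integrable_mul hf.star).add (hf.integrable_mul hf'.star)
  have key : ∀ l : Filter ℝ, Tendsto (fun x => f x * star (f x)) l (𝓝 0) → Tendsto f l (𝓝 0) := by
    intro l hl
    have h1 : Tendsto (fun x => √‖f x * star (f x)‖) l (𝓝 0) := by
      have := (Real.continuous_sqrt.tendsto _).comp hl.norm
      rw [norm_zero, Real.sqrt_zero] at this
      exact this
    rw [tendsto_zero_iff_norm_tendsto_zero]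
    refine h1.congr fun x => ?_
    rw [norm_mul, norm_star, Real.sqrt_mul_self (norm_nonneg _)]
  rw [cocompact_eq_atBot_atTop]
  refine Tendsto.sup (key _ ?_) (key _ ?_)
  · exact tendsto_zero_of_hasDerivAt_of_integrableOn_Iic (a := 0) (fun x _ => hd x)
      i2.integrableOn i1.integrableOn
  · exact tendsto_zero_of_hasDerivAt_of_integrableOn_Ioi (a := 0) (fun x _ => hd x)
      i2.integrableOn i1.integrableOn

/-- Near infinity the limit `1` bounds `‖d‖` from below, and on a compact set continuity does. -/
theorem exists_pos_le_norm_of_tendsto_one {d : ℝ → ℂ} (hd : Continuous d) (h0 : ∀ z, d z ≠ 0)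
    (h1 : Tendsto d (cocompact ℝ) (𝓝 1)) : ∃ c : ℝ, 0 < c ∧ ∀ z, c ≤ ‖d z‖ := by
  have h2 : ∀ᶠ z in cocompact ℝ, 1 / 2 < ‖d z‖ := by
    have := h1.norm
    rw [norm_one] at this
    exact this.eventually_const_lt (by norm_num)
  obtain ⟨K, hK, hKs⟩ := mem_cocompact.1 h2
  rcases K.eq_empty_or_nonempty with hE | hE
  · refine ⟨1 / 2, by norm_num, fun z => le_of_lt (hKs ?_)⟩
    simp [hE]
  · obtain ⟨x, _, hx⟩ := hK.exists_isMinOn hE hd.norm.continuousOn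
    refine ⟨min (1 / 2) ‖d x‖, lt_min (by norm_num) (norm_pos_iff.2 (h0 x)), fun z => ?_⟩
    by_cases hz : z ∈ K
    · exact (min_le_right _ _).trans (hx hz)
    · exact (min_le_left _ _).trans (le_of_lt (hKs hz))

/-- Quotients by a differentiable function that is bounded away from zero stay in `H^{1,1}`. -/
theorem memWeightedSobolev_div {f f' d d' : ℝ → ℂ} {c : ℝ} (hf : MemLp f 2 volume)
    (hzf : MemLp (fun z : ℝ => (z : ℂ) * f z) 2 volume) (hf' : MemLp f' 2 volume)
    (hfd : ∀ z, HasDerivAt f (f' z) z) (hf1 : ∀ z, ‖f z‖ ≤ 1)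
    (hd' : MemLp d' 2 volume) (hdd : ∀ z, HasDerivAt d (d' z) z) (hc : 0 < c)
    (hdc : ∀ z, c ≤ ‖d z‖) : MemWeightedSobolev 1 1 fun z => f z / d z := by
  have hd0 : ∀ z, d z ≠ 0 := fun z => norm_pos_iff.1 (hc.trans_le (hdc z))
  have hfc : Continuous f := continuous_iff_continuousAt.2 fun z => (hfd z).continuousAt
  have hdcont : Continuous d := continuous_iff_continuousAt.2 fun z => (hdd z).continuousAt
  have hdiv : ∀ {u : ℝ → ℂ}, MemLp u 2 volume → MemLp (fun z => u z / d z) 2 volume := by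
    intro u hu
    refine hu.of_le_mul (c := c⁻¹) (hu.1.mul (hdcont.inv₀ hd0).aestronglyMeasurable)
      (Eventually.of_forall fun z => ?_)
    rw [norm_div, div_eq_inv_mul]
    gcongr
    exact hdc z
  refine ⟨hdiv hf, ?_, fun j hj1 hj2 => ?_⟩
  · refine ((hdiv hf).norm.add (hdiv hzf).norm).mono ?_ (Eventually.of_forall fun z => ?_)
    · have : Continuous fun z : ℝ => (1 + |z| ^ (1 : ℝ)) • (f z / d z) := by
        simp only [Real.rpow_one]
        exact (continuous_const.add continuous_abs).smul (hfc.div hdcont hd0)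
      exact this.aestronglyMeasurable
    · have h0 : 0 < 1 + |z| := by positivity
      refine le_trans (le_of_eq ?_) (Real.le_norm_self _)
      rw [Real.rpow_one, norm_smul, Real.norm_eq_abs, abs_of_pos h0]
      simp only [Pi.add_apply]
      rw [norm_div, norm_div, norm_mul, Complex.norm_real, Real.norm_eq_abs]
      ring
  · obtain rfl : j = 1 := le_antisymm hj2 hj1
    have hg : MemLp (fun z => f' z / d z - f z / d z * (d' z / d z)) 2 volume := by
      refine (hdiv hf').sub ((hdiv hd').of_le_mul (c := c⁻¹)
        ((hfc.div hdcont hd0).aestronglyMeasurable.mul (hdiv hd').1)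
        (Eventually.of_forall fun z => ?_))
      rw [norm_mul, norm_div]
      gcongr
      rw [inv_eq_one_div]
      exact div_le_div₀ zero_le_one (hf1 z) hc (hdc z)
    refine ⟨_, hg, isWeakDeriv_of_hasDerivAt (hg.locallyIntegrable (by norm_num)) fun z => ?_⟩
    refine ((hfd z).div (hdd z) (hd0 z)).congr_deriv ?_
    have := hd0 z
    field_simp

open scoped Matrix.Norms.L2Operator

local notation "Mat" => Matrix (Fin 3) (Fin 3) ℂ

variable {a : Fin 3 → ℝ} {P P' : ℝ → Mat} {M : ℝ → ℝ → Mat}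

theorem IsPotential.memWeightedSobolev_scatter_div (h : IsPotential P P')
    (ha : Function.Injective a) (hM : ∀ z, IsJost (coeff a P z) (M z)) {i j : Fin 3} (hij : i ≠ j)
    (h0 : ∀ z, scatter (coeff a P z) (M z) i i ≠ 0) :
    MemWeightedSobolev 1 1 fun z =>
      scatter (coeff a P z) (M z) i j / scatter (coeff a P z) (M z) i i := by
  obtain ⟨S', hS', hd⟩ := h.exists_hasDerivAt_scatter ha hM
  have hde : ∀ k l z, HasDerivAt (fun z => scatter (coeff a P z) (M z) k l) (S' z k l) z :=
    fun k l z => ((entryCLM k l).restrictScalars ℝ).hasFDerivAt.comp_hasDerivAt z (hd z)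
  have hS1 := h.memLp_scatter_sub_one ha hM
  have hlim : Tendsto (fun z => scatter (coeff a P z) (M z) i i) (cocompact ℝ) (𝓝 1) := by
    have h1 := tendsto_zero_of_memLp_two_of_hasDerivAt (memLp_entry hS1 i i) (memLp_entry hS' i i)
      fun z => by
        simp only [Matrix.sub_apply, Matrix.one_apply_eq]
        exact (hde i i z).sub_const 1
    have h2 := h1.add_const 1
    simpa using h2
  obtain ⟨c, hc, hcd⟩ := exists_pos_le_norm_of_tendsto_one
    (continuous_iff_continuousAt.2 fun z => (hde i i z).continuousAt) h0 hlim
  refine memWeightedSobolev_div ?_ (h.memLp_id_mul_scatter ha hM hij) (memLp_entry hS' i j)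
    (hde i j) (fun z => ?_) (memLp_entry hS' i i) (hde i i) hc hcd
  · refine (memLp_entry hS1 i j).ae_eq (Eventually.of_forall fun z => ?_)
    simp [Matrix.sub_apply, Matrix.one_apply_ne hij]
  · exact entry_norm_bound_of_unitary ((hM z).scatter_mem_unitary (h.isSkewPotential a z)) i j

/-! ### The Volterra equations -/

theorem expHat_integral (a : Fin 3 → ℝ) (θ : ℝ) {f : ℝ → Mat} {s : Set ℝ}
    (hf : IntegrableOn f s) : expHat a θ (∫ y in s, f y) = ∫ y in s, expHat a θ (f y) := by
  simp only [expHat_eq]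
  rw [integral_mul_const_of_integrable (hf.const_mul _), integral_const_mul_of_integrable hf]

theorem integrableOn_expHat_iff (a : Fin 3 → ℝ) (θ : ℝ) {f : ℝ → Mat} {s : Set ℝ} :
    IntegrableOn (fun y => expHat a θ (f y)) s ↔ IntegrableOn f s := by
  have h : ∀ (θ : ℝ) (f : ℝ → Mat), IntegrableOn f s →
      IntegrableOn (fun y => expHat a θ (f y)) s := fun θ f hf =>
    Integrable.mono hf (aestronglyMeasurable_expHat a aestronglyMeasurable_const hf.1)
      (Eventually.of_forall fun y => (norm_expHat _ _ _).le)
  refine ⟨fun hf => ?_, h θ f⟩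
  have := h (-θ) _ hf
  simpa only [expHat_expHat, neg_add_cancel, expHat_zero] using this

theorem isJostPlus_iff_matrix {μ : ℝ → ℝ → Mat} : IsJostPlus a P μ ↔ ∀ x z,
    IntegrableOn (fun y => expHat a (z * (x - y)) (P y * μ y z)) (Ioi x) ∧
    μ x z = 1 - ∫ y in Ioi x, expHat a (z * (x - y)) (P y * μ y z) := by
  constructor
  · intro h x z
    have hi : IntegrableOn (fun y => expHat a (z * (x - y)) (P y * μ y z)) (Ioi x) :=
      integrable_matrix fun i j => (h x z i j).1
    refine ⟨hi, ?_⟩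
    ext i j
    rw [(h x z i j).2, Matrix.sub_apply, integral_entry hi]
  · intro h x z i j
    refine ⟨(entryCLM i j).integrable_comp (h x z).1, ?_⟩
    rw [(h x z).2, Matrix.sub_apply, integral_entry (h x z).1]

/-- In terms of `e^{-izxÂ} μ(x, z)` the Volterra equation becomes the linear system with
coefficients `coeff a P z` and the normalization `1` at `+∞`. -/
theorem IsPotential.isJostPlus_iff (h : IsPotential P P') {μ : ℝ → ℝ → Mat} :
    IsJostPlus a P μ ↔ ∀ z, IsJost (coeff a P z) fun x => expHat a (-(z * x)) (μ x z) := by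
  have e : ∀ x z y, expHat a (-(z * x)) (expHat a (z * (x - y)) (P y * μ y z)) =
      coeff a P z y * expHat a (-(z * y)) (μ y z) := by
    intro x z y
    rw [expHat_expHat, coeff, ← expHat_mul]
    congr 1
    ring
  rw [isJostPlus_iff_matrix]
  constructor
  · intro hμ z
    refine isJost_of_eq_tailIntegral (h.isSkewPotential a z).cont (fun x => ?_) fun x => ?_
    · have := (integrableOn_expHat_iff a (-(z * x))).2 (hμ x z).1
      simpa only [e] using this
    · have := congrArg (expHat a (-(z * x))) (hμ x z).2
      rw [expHat_sub, expHat_one, expHat_integral _ _ (hμ x z).1] at this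
      simpa only [e] using this
  · intro hM x z
    have hi := ((hM z).integrable_mul (h.isSkewPotential a z)).integrableOn (s := Ioi x)
    have hi' : IntegrableOn (fun y => expHat a (z * (x - y)) (P y * μ y z)) (Ioi x) := by
      rw [← integrableOn_expHat_iff a (-(z * x))]
      simpa only [e] using hi
    refine ⟨hi', ?_⟩
    have h1 := (hM z).eq_tailIntegral (h.isSkewPotential a z) x
    simp only [← e x z] at h1
    rw [← expHat_integral _ _ hi'] at h1
    have h2 := congrArg (expHat a (z * x)) h1
    simpa only [expHat_sub, expHat_one, expHat_expHat, add_neg_cancel, expHat_zero] using h2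

/-- The reflection `x ↦ -x` exchanges the two normalizations. Since the phases depend on `z x`, it
changes the sign of the exponents; it also replaces the potential by `-P(-x)`. -/
theorem isJostMinus_iff_isJostPlus {μ : ℝ → ℝ → Mat} : IsJostMinus a P μ ↔
    IsJostPlus (-a) (fun y => -P (-y)) fun x z => μ (-x) z := by
  have e : ∀ (x z y : ℝ), expHat (-a) (z * (x - y)) (-P (-y) * μ (-y) z) =
      -expHat a (z * (-x - -y)) (P (-y) * μ (-y) z) := by
    intro x z y
    rw [expHat_neg_exponents, neg_mul, expHat_neg]
    congr 2
    ring
  have key : ∀ (x z : ℝ) (i j : Fin 3),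
      (IntegrableOn (fun y => expHat (-a) (z * (x - y)) (-P (-y) * μ (-y) z) i j) (Ioi x) ↔
        IntegrableOn (fun y => expHat a (z * (-x - y)) (P y * μ y z) i j) (Iio (-x))) ∧
      ∫ y in Ioi x, expHat (-a) (z * (x - y)) (-P (-y) * μ (-y) z) i j =
        -∫ y in Iio (-x), expHat a (z * (-x - y)) (P y * μ y z) i j := by
    intro x z i j
    simp only [e, Matrix.neg_apply]
    constructor
    · have hn := (Measure.measurePreserving_neg (volume : Measure ℝ)).integrableOn_comp_preimage
        (f := fun y => expHat a (z * (-x - y)) (P y * μ y z) i j) (s := Iio (-x))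
        (Homeomorph.neg ℝ).measurableEmbedding
      rw [show (Neg.neg ⁻¹' Iio (-x) : Set ℝ) = Ioi x by ext; simp] at hn
      exact integrableOn_neg_iff.trans hn
    · rw [integral_neg, integral_comp_neg_Ioi x
        (fun y => expHat a (z * (-x - y)) (P y * μ y z) i j), integral_Iic_eq_integral_Iio]
  constructor
  · intro h x z i j
    have := h (-x) z i j
    refine ⟨(key x z i j).1.2 this.1, ?_⟩
    rw [(key x z i j).2, sub_neg_eq_add]
    exact this.2
  · intro h x z i j
    have := h (-x) z i j
    have k := key (-x) z i j
    rw [neg_neg] at k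
    refine ⟨k.1.1 this.1, ?_⟩
    have t2 : μ (- -x) z i j = _ := this.2
    rw [k.2, sub_neg_eq_add, neg_neg] at t2
    exact t2

theorem IsPotential.existsUnique_isJostPlus (h : IsPotential P P') (a : Fin 3 → ℝ) :
    ∃! μ : ℝ → ℝ → Mat, IsJostPlus a P μ := by
  choose M hM using fun z =>
    exists_isJost (h.isSkewPotential a z).cont (h.isSkewPotential a z).integrable
  refine ⟨fun x z => expHat a (z * x) (M z x), ?_, fun ν hν => ?_⟩
  · refine h.isJostPlus_iff.2 ?_
    simpa only [expHat_expHat, neg_add_cancel, expHat_zero] using hM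
  · replace hν := h.isJostPlus_iff.1 hν
    funext x z
    have := congrFun ((hM z).unique (h.isSkewPotential a z) (hν z)) x
    rw [← this, expHat_expHat, add_neg_cancel, expHat_zero]

theorem IsPotential.existsUnique_isJostMinus (h : IsPotential P P') (a : Fin 3 → ℝ) :
    ∃! μ : ℝ → ℝ → Mat, IsJostMinus a P μ := by
  obtain ⟨ν, hν, hu⟩ := h.reflect.existsUnique_isJostPlus (-a)
  refine ⟨fun x z => ν (-x) z, ?_, fun μ hμ => ?_⟩
  · beta_reduce
    rw [isJostMinus_iff_isJostPlus]
    simpa only [neg_neg] using hν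
  · have := hu _ (isJostMinus_iff_isJostPlus.1 hμ)
    funext x z
    rw [← this]
    beta_reduce
    rw [neg_neg]

/-- The scattering matrix is the limit at `-∞` of the solution normalized at `+∞`. -/
theorem IsPotential.isScatteringMatrix_iff (h : IsPotential P P') {μp μm : ℝ → ℝ → Mat}
    (hp : IsJostPlus a P μp) (hm : IsJostMinus a P μm) {S : ℝ → Mat} :
    IsScatteringMatrix a μp μm S ↔ S = fun z =>
      scatter (coeff a P z) fun x => expHat a (-(z * x)) (μp x z) := by
  rw [h.isJostPlus_iff] at hp
  rw [isJostMinus_iff_isJostPlus, h.reflect.isJostPlus_iff] at hm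
  set M : ℝ → ℝ → Mat := fun z x => expHat a (-(z * x)) (μp x z) with hM
  have hμp : ∀ x z, μp x z = expHat a (z * x) (M z x) := fun x z => by
    simp only [hM, expHat_expHat, add_neg_cancel, expHat_zero]
  -- `M S*` is the solution normalized at `-∞`
  have hμm : ∀ x z, μm x z = expHat a (z * x) (M z x * star (scatter (coeff a P z) (M z))) := by
    intro x z
    have h1 := congrFun ((h.reflect_jost hp z).unique (h.reflect.isSkewPotential (-a) z) (hm z))
      (-x)
    simp only [neg_neg, expHat_neg_exponents] at h1
    rw [← h1, expHat_expHat]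
    rw [show z * x + z * -x = 0 by ring, expHat_zero]
  have hu := fun z => (hp z).scatter_mem_unitary (h.isSkewPotential a z)
  constructor
  · intro hS
    funext z
    have h1 := hS 0 z
    have hM0 := Unitary.star_mul_self_of_mem ((hp z).mem_unitary (h.isSkewPotential a z) 0)
    rw [hμp, hμm] at h1
    simp only [mul_zero, expHat_zero] at h1
    have h2 := congrArg (fun X => scatter (coeff a P z) (M z) * (star (M z 0) * X)) h1
    beta_reduce at h2
    rw [hM0, mul_one, mul_assoc (M z 0), ← mul_assoc (star (M z 0)), hM0, one_mul, ← mul_assoc,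
      Unitary.mul_star_self_of_mem (hu z), one_mul] at h2
    exact h2.symm
  · rintro rfl x z
    rw [hμp, hμm, ← expHat_mul, mul_assoc, Unitary.star_mul_self_of_mem (hu z), mul_one]

/-! ### The reflection coefficients -/

/-- For a unitary matrix `U` the adjugate is `det U • star U`, so the diagonal cofactors are the
diagonal entries up to conjugation and a factor. -/
theorem ne_zero_of_cofactorMatrix_ne_zero {U : Mat} (hU : U ∈ unitary Mat) (i : Fin 3)
    (h : cofactorMatrix U i i ≠ 0) : U i i ≠ 0 := by
  have e : U.adjugate = U.det • star U := by
    calc U.adjugate = U.adjugate * (U * star U) := by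
          rw [Unitary.mul_star_self_of_mem hU, mul_one]
      _ = U.det • star U := by
          rw [← mul_assoc, Matrix.adjugate_mul, Matrix.smul_mul, one_mul]
  intro h0
  apply h
  rw [cofactorMatrix, Matrix.transpose_apply, e, Matrix.smul_apply, Matrix.star_apply, h0]
  simp

theorem IsPotential.memWeightedSobolev_reflection (h : IsPotential P P')
    (ha : Function.Injective a) {μp μm : ℝ → ℝ → Mat} (hp : IsJostPlus a P μp)
    (hm : IsJostMinus a P μm) {S : ℝ → Mat} (hS : IsScatteringMatrix a μp μm S)
    (h0 : ∀ z, S z 0 0 ≠ 0) (h2 : ∀ z, cofactorMatrix (S z) 2 2 ≠ 0) :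
    MemWeightedSobolev 1 1 (r₁ S) ∧ MemWeightedSobolev 1 1 (r₂ S) ∧
      MemWeightedSobolev 1 1 (r₃ S) ∧ MemWeightedSobolev 1 1 (r₄ S) := by
  obtain rfl := (h.isScatteringMatrix_iff hp hm).1 hS
  have hM := h.isJostPlus_iff.1 hp
  have h2' := fun z => ne_zero_of_cofactorMatrix_ne_zero
    ((hM z).scatter_mem_unitary (h.isSkewPotential a z)) 2 (h2 z)
  exact ⟨h.memWeightedSobolev_scatter_div ha hM (by decide) h0,
    h.memWeightedSobolev_scatter_div ha hM (by decide) h2',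
    h.memWeightedSobolev_scatter_div ha hM (by decide) h2',
    h.memWeightedSobolev_scatter_div ha hM (by decide) h0⟩

/-- The Volterra equations depend on the potential only up to null sets, so that a continuous
representative may be used. -/
theorem isJostPlus_congr {Q : ℝ → Mat} (hPQ : P =ᵐ[volume] Q) {μ : ℝ → ℝ → Mat} :
    IsJostPlus a P μ ↔ IsJostPlus a Q μ := by
  have e : ∀ x z i j, (fun y => expHat a (z * (x - y)) (P y * μ y z) i j)
      =ᵐ[volume.restrict (Ioi x)]
      fun y => expHat a (z * (x - y)) (Q y * μ y z) i j := fun x z i j => by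
    filter_upwards [ae_restrict_of_ae hPQ] with y hy
    rw [hy]
  refine forall_congr' fun x => forall_congr' fun z => forall_congr' fun i =>
    forall_congr' fun j => ?_
  rw [integrableOn_congr_fun_ae (e x z i j), integral_congr_ae (e x z i j)]

theorem isJostMinus_congr {Q : ℝ → Mat} (hPQ : P =ᵐ[volume] Q) {μ : ℝ → ℝ → Mat} :
    IsJostMinus a P μ ↔ IsJostMinus a Q μ := by
  have e : ∀ x z i j, (fun y => expHat a (z * (x - y)) (P y * μ y z) i j)
      =ᵐ[volume.restrict (Iio x)]
      fun y => expHat a (z * (x - y)) (Q y * μ y z) i j := fun x z i j => by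
    filter_upwards [ae_restrict_of_ae hPQ] with y hy
    rw [hy]
  refine forall_congr' fun x => forall_congr' fun z => forall_congr' fun i =>
    forall_congr' fun j => ?_
  rw [integrableOn_congr_fun_ae (e x z i j), integral_congr_ae (e x z i j)]

/-! ### Potentials of the three-wave equation -/

theorem isPotential_potential {p₁ p₂ p₃ g₁ g₂ g₃ : ℝ → ℂ} (h₁ : IsSobolevRep p₁ g₁)
    (h₂ : IsSobolevRep p₂ g₂) (h₃ : IsSobolevRep p₃ g₃) :
    IsPotential (potential p₁ p₂ p₃) (potential g₁ g₂ g₃) := by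
  have hneg : ∀ {p g : ℝ → ℂ}, IsSobolevRep p g →
      IsSobolevRep (fun x => -(starRingEnd ℂ) (p x)) fun x => -(starRingEnd ℂ) (g x) :=
    fun h => by simpa using h.conj.const_mul (-1)
  refine ⟨fun i j => ?_, fun x => ?_, fun x i => ?_⟩
  · fin_cases i <;> fin_cases j
    exacts [isSobolevRep_zero, h₁, h₂, hneg h₁, isSobolevRep_zero, h₃, hneg h₂, hneg h₃,
      isSobolevRep_zero]
  · ext i j
    fin_cases i <;> fin_cases j <;> simp [potential, Matrix.star_apply]
  · fin_cases i <;> rfl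

end Reflection

end ThreeWave

theorem mainTheorem2 (a : Fin 3 → ℝ) (ha₁₂ : a 1 < a 0) (ha₂₃ : a 2 < a 1)
    (p₁₂ p₁₃ p₂₃ : ℝ → ℂ)
    (h₁₂ : MemWeightedSobolev 1 2 p₁₂) (h₁₃ : MemWeightedSobolev 1 2 p₁₃)
    (h₂₃ : MemWeightedSobolev 1 2 p₂₃) :
    (∃! μp : ℝ → ℝ → Matrix (Fin 3) (Fin 3) ℂ,
      ThreeWave.IsJostPlus a (ThreeWave.potential p₁₂ p₁₃ p₂₃) μp) ∧
    (∃! μm : ℝ → ℝ → Matrix (Fin 3) (Fin 3) ℂ,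
      ThreeWave.IsJostMinus a (ThreeWave.potential p₁₂ p₁₃ p₂₃) μm) ∧
    ∀ μp μm : ℝ → ℝ → Matrix (Fin 3) (Fin 3) ℂ,
      ThreeWave.IsJostPlus a (ThreeWave.potential p₁₂ p₁₃ p₂₃) μp →
      ThreeWave.IsJostMinus a (ThreeWave.potential p₁₂ p₁₃ p₂₃) μm →
      (∃! S : ℝ → Matrix (Fin 3) (Fin 3) ℂ, ThreeWave.IsScatteringMatrix a μp μm S) ∧
      ∀ S : ℝ → Matrix (Fin 3) (Fin 3) ℂ, ThreeWave.IsScatteringMatrix a μp μm S →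
        (∀ z : ℝ, S z 0 0 ≠ 0) →
        (∀ z : ℝ, ThreeWave.cofactorMatrix (S z) 2 2 ≠ 0) →
        MemWeightedSobolev 1 1 (ThreeWave.r₁ S) ∧
        MemWeightedSobolev 1 1 (ThreeWave.r₂ S) ∧
        MemWeightedSobolev 1 1 (ThreeWave.r₃ S) ∧
        MemWeightedSobolev 1 1 (ThreeWave.r₄ S) := by
  obtain ⟨q₁, g₁, hq₁, e₁⟩ := ThreeWave.exists_isSobolevRep h₁₂
  obtain ⟨q₂, g₂, hq₂, e₂⟩ := ThreeWave.exists_isSobolevRep h₁₃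
  obtain ⟨q₃, g₃, hq₃, e₃⟩ := ThreeWave.exists_isSobolevRep h₂₃
  have h := ThreeWave.isPotential_potential hq₁ hq₂ hq₃
  have hae : ThreeWave.potential p₁₂ p₁₃ p₂₃ =ᵐ[volume] ThreeWave.potential q₁ q₂ q₃ := by
    filter_upwards [e₁, e₂, e₃] with x h1 h2 h3
    simp only [ThreeWave.potential, h1, h2, h3]
  have ha : Function.Injective a := by
    have : StrictAnti a := by
      refine Fin.strictAnti_iff_succ_lt.2 fun i => ?_
      fin_cases i
      exacts [ha₁₂, ha₂₃]
    exact this.injective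
  simp only [ThreeWave.isJostPlus_congr hae, ThreeWave.isJostMinus_congr hae]
  refine ⟨h.existsUnique_isJostPlus a, h.existsUnique_isJostMinus a, fun μp μm hp hm => ?_⟩
  refine ⟨?_, fun S hS h0 h2 => h.memWeightedSobolev_reflection ha hp hm hS h0 h2⟩
  simp only [h.isScatteringMatrix_iff hp hm]
  exact existsUnique_eq
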